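/- For $n\in\mathbb N$ let $A_s(n)$ be the universal unital $C^*$-algebra generated by elements $u_{ij}$ ($1\le i,j\le n$) which are orthogonal projections, such that different entries in the same row or in the same column of $u=(u_{ij})$ are orthogonal and every row and every column of $u$ sums up to $1$. Let $\Delta(u_{ij})=\sum_k u_{ik}\otimes u_{kj}$ be its comultiplication. (1) There is exactly one Haar state on $A_s(n)$, i.e. exactly one state $\psi$ with $(\mathrm{id}\otimes\psi)\Delta(a)=\psi(a)1=(\psi\otimes\mathrm{id})\Delta(a)$ for all $a$ in the dense $*$-algebra generated by the $u_{ij}$. (2) Let $\pi$ be the GNS representation of $\psi$ with cyclic vector $\Omega$, let $\mathcal A=\pi(A_s(n))''$ be the von Neumann algebra generated by its image, and denote by $\psi$ also the vector state $\langle\Omega,\,\cdot\,\Omega\rangle$ on $\mathcal A$. It extends the Haar state, i.e. $\langle\Omega,\pi(a)\Omega\rangle=\psi(a)$ for all $a\in A_s(n)$, and $(\mathcal A,\psi)$ is a $W^*$-probability space, i.e. $\psi$ is a faithful normal state on $\mathcal A$. (3) For every column $c\in\{1,\dots,n\}$ (in particular for the first column $c=1$) the elements $x_i:=\pi(u_{ic})\in\mathcal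 A$, $i=1,\dots,n$, are quantum exchangeable with respect to $\psi$: for all $k\le n$, all $m\ge 0$ and all $i(1),\dots,i(m)\in\{1,\dots,k\}$, $$\psi(x_{i(1)}\cdots x_{i(m)})\,1=\sum_{j(1),\dots,j(m)=1}^k \psi(x_{j(1)}\cdots x_{j(m)})\,u_{i(1)j(1)}\cdots u_{i(m)j(m)}\qquad\text{in }A_s(k).$$ (4) If $n\ge 2$, then for every column $c$ (in particular for the first one) there are no von Neumann subalgebra $\mathcal B\subset\mathcal A$ (with the same unit) and conditional expectation $E:\mathcal A\to\mathcal B$ with $\psi\circ E=\psi$ such that $x_1,\dots,x_n$ are identically distributed and free with respect to $E$. Here a conditional expectation is a linear map $E:\mathcal A\to\mathcal B$ with $E[b]=b$ and $E[b_1ab_2]=b_1E[a]b_2$ for all $b,b_1,b_2\in\mathcal B$, $a\in\mathcal A$. Let $\mathcal B\langle X\rangle$ be the algebra of $\mathcal B$-valued polynomials, i.e. of linear combinations of words $b_0Xb_1X\cdots Xb_r$, where $X$ does not commute with $\mathcal B$. Identically distributed means that $E[p(x_i)]$ does not depend on $i$, for each $p\in\mathcal B\langle X\rangle$. Free means that $E[p_1(x_{i(1)})\cdots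 p_m(x_{i(m)})]=0$ whenever $m\ge1$, $i(1)\ne i(2)\ne\dots\ne i(m)$, $p_1,\dots,p_m\in\mathcal B\langle X\rangle$ and $E[p_r(x_{i(r)})]=0$ for all $r$. Hence the noncommutative de Finetti theorem (quantum exchangeability of a sequence implies freeness and identical distribution with respect to a conditional expectation) fails for finite sequences. -/

import Mathlib

open scoped TensorProduct ComplexOrder InnerProductSpace

noncomputable section

namespace QuantumDeFinetti

/-! ### The quantum permutation group -/

/-- The algebraic (star-free) part of the defining relations of the quantum permutation group:
the entries of `v` are idempotents, different entries in the same row or in the same column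
annihilate each other, and every row and every column sums up to `1`. -/
structure MagicRelations {n : ℕ} {R : Type*} [Ring R] (v : Fin n → Fin n → R) : Prop where
  idem : ∀ i j, v i j * v i j = v i j
  row_orth : ∀ i k l, k ≠ l → v i k * v i l = 0
  col_orth : ∀ i k l, k ≠ l → v k i * v l i = 0
  row_sum : ∀ i, ∑ k, v i k = 1
  col_sum : ∀ i, ∑ k, v k i = 1

/-- A magic unitary: a square matrix over a star ring all of whose entries are orthogonal
projections, such that the entries in each row and in each column form a partition of unity. -/
structure IsMagicUnitary {n : ℕ} {R : Type*} [Ring R] [StarRing R]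
    (v : Fin n → Fin n → R) : Prop extends MagicRelations v where
  star_eq : ∀ i j, star (v i j) = v i j

/-- The relations among the free generators `u i j` which define the algebra below. -/
inductive PolyRel (n : ℕ) :
    FreeAlgebra ℂ (Fin n × Fin n) → FreeAlgebra ℂ (Fin n × Fin n) → Prop
  | idem (i j : Fin n) : PolyRel n
      (FreeAlgebra.ι ℂ (i, j) * FreeAlgebra.ι ℂ (i, j)) (FreeAlgebra.ι ℂ (i, j))
  | row_orth (i k l : Fin n) (h : k ≠ l) : PolyRel n
      (FreeAlgebra.ι ℂ (i, k) * FreeAlgebra.ι ℂ (i, l)) 0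
  | col_orth (i k l : Fin n) (h : k ≠ l) : PolyRel n
      (FreeAlgebra.ι ℂ (k, i) * FreeAlgebra.ι ℂ (l, i)) 0
  | row_sum (i : Fin n) : PolyRel n (∑ k, FreeAlgebra.ι ℂ (i, k)) 1
  | col_sum (i : Fin n) : PolyRel n (∑ k, FreeAlgebra.ι ℂ (k, i)) 1

/-- The universal unital complex *-algebra generated by the entries of an `n × n` magic unitary
(the dense Hopf *-algebra of the quantum permutation group). -/
def PolyAlg (n : ℕ) : Type := RingQuot (PolyRel n)

namespace PolyAlg

variable {n : ℕ}

instance : Ring (PolyAlg n) := inferInstanceAs (Ring (RingQuot (PolyRel n)))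
instance : Algebra ℂ (PolyAlg n) := inferInstanceAs (Algebra ℂ (RingQuot (PolyRel n)))

/-- The quotient map from the free algebra. -/
def mk (n : ℕ) : FreeAlgebra ℂ (Fin n × Fin n) →ₐ[ℂ] PolyAlg n :=
  RingQuot.mkAlgHom ℂ (PolyRel n)

/-- The generators. -/
def gen (i j : Fin n) : PolyAlg n := mk n (FreeAlgebra.ι ℂ (i, j))

theorem magicRelations_gen : MagicRelations (gen : Fin n → Fin n → PolyAlg n) where
  idem i j := by
    have := RingQuot.mkAlgHom_rel ℂ (PolyRel.idem i j)
    rwa [map_mul] at this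
  row_orth i k l h := by
    have := RingQuot.mkAlgHom_rel ℂ (PolyRel.row_orth i k l h)
    rwa [map_mul, map_zero] at this
  col_orth i k l h := by
    have := RingQuot.mkAlgHom_rel ℂ (PolyRel.col_orth i k l h)
    rwa [map_mul, map_zero] at this
  row_sum i := by
    have := RingQuot.mkAlgHom_rel ℂ (PolyRel.row_sum i)
    rwa [map_sum, map_one] at this
  col_sum i := by
    have := RingQuot.mkAlgHom_rel ℂ (PolyRel.col_sum i)
    rwa [map_sum, map_one] at this

/-- The universal property with respect to algebra homomorphisms. -/
def lift {R : Type*} [Ring R] [Algebra ℂ R] (v : Fin n → Fin n → R) (hv : MagicRelations v) :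
    PolyAlg n →ₐ[ℂ] R :=
  RingQuot.liftAlgHom ℂ ⟨FreeAlgebra.lift ℂ fun p : Fin n × Fin n => v p.1 p.2, by
    intro x y h
    induction h with
    | idem i j => simpa using hv.idem i j
    | row_orth i k l h => simpa using hv.row_orth i k l h
    | col_orth i k l h => simpa using hv.col_orth i k l h
    | row_sum i => simpa using hv.row_sum i
    | col_sum i => simpa using hv.col_sum i⟩

@[simp]
theorem lift_gen {R : Type*} [Ring R] [Algebra ℂ R] (v : Fin n → Fin n → R)
    (hv : MagicRelations v) (i j : Fin n) : lift v hv (gen i j) = v i j := by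
  have := RingQuot.liftAlgHom_mkAlgHom_apply (S := ℂ) (s := PolyRel n)
    (FreeAlgebra.lift ℂ fun p : Fin n × Fin n => v p.1 p.2)
  simp only [lift, gen, mk]
  erw [this]
  simp

theorem induction_on {P : PolyAlg n → Prop} (a : PolyAlg n)
    (halg : ∀ c : ℂ, P (algebraMap ℂ _ c)) (hgen : ∀ i j, P (gen i j))
    (hmul : ∀ a b, P a → P b → P (a * b)) (hadd : ∀ a b, P a → P b → P (a + b)) : P a := by
  obtain ⟨x, rfl⟩ := RingQuot.mkAlgHom_surjective ℂ (PolyRel n) a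
  change P (mk n x)
  induction x using FreeAlgebra.induction with
  | grade0 r => simpa using halg r
  | grade1 p => exact hgen p.1 p.2
  | mul a b ha hb => simpa using hmul _ _ ha hb
  | add a b ha hb => simpa using hadd _ _ ha hb

/-- The opposite algebra with scalars acting through complex conjugation. -/
abbrev conjOpAlgebra (n : ℕ) : Algebra ℂ (PolyAlg n)ᵐᵒᵖ :=
  Algebra.compHom _ (starRingEnd ℂ)

/-- The conjugate linear antihomomorphism which fixes the generators. -/
def starHom (n : ℕ) : PolyAlg n →+* (PolyAlg n)ᵐᵒᵖ :=
  letI := conjOpAlgebra n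
  (lift (n := n) (fun i j => MulOpposite.op (gen i j))
    { idem := fun i j => by rw [← MulOpposite.op_mul, magicRelations_gen.idem]
      row_orth := fun i k l h => by
        rw [← MulOpposite.op_mul, magicRelations_gen.row_orth _ _ _ h.symm, MulOpposite.op_zero]
      col_orth := fun i k l h => by
        rw [← MulOpposite.op_mul, magicRelations_gen.col_orth _ _ _ h.symm, MulOpposite.op_zero]
      row_sum := fun i => by
        rw [← Finset.op_sum, magicRelations_gen.row_sum, MulOpposite.op_one]
      col_sum := fun i => by
        rw [← Finset.op_sum, magicRelations_gen.col_sum, MulOpposite.op_one] } :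
      PolyAlg n →ₐ[ℂ] (PolyAlg n)ᵐᵒᵖ).toRingHom

theorem starHom_gen (i j : Fin n) : starHom n (gen i j) = MulOpposite.op (gen i j) := by
  let _ := conjOpAlgebra n
  exact lift_gen _ _ i j

theorem starHom_algebraMap (c : ℂ) :
    starHom n (algebraMap ℂ _ c) = MulOpposite.op (algebraMap ℂ _ (star c)) := by
  let _ := conjOpAlgebra n
  unfold starHom
  exact AlgHom.commutes _ c

/-- The involution, determined by `star (gen i j) = gen i j`. -/
instance : StarRing (PolyAlg n) where
  star a := (starHom n a).unop
  star_involutive a := by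
    induction a using induction_on with
    | halg c => simp [starHom_algebraMap]
    | hgen i j => simp [starHom_gen]
    | hmul a b ha hb => simp [ha, hb]
    | hadd a b ha hb => simp [ha, hb]
  star_mul a b := by simp
  star_add a b := by simp

theorem star_gen (i j : Fin n) : star (gen i j : PolyAlg n) = gen i j := by
  change (starHom n _).unop = _
  rw [starHom_gen, MulOpposite.unop_op]

theorem star_algebraMap (c : ℂ) :
    star (algebraMap ℂ (PolyAlg n) c) = algebraMap ℂ _ (star c) := by
  change (starHom n _).unop = _
  rw [starHom_algebraMap, MulOpposite.unop_op]

instance : StarModule ℂ (PolyAlg n) where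
  star_smul c a := by
    rw [Algebra.smul_def, star_mul, star_algebraMap, Algebra.smul_def, Algebra.commutes]

theorem isMagicUnitary_gen : IsMagicUnitary (gen : Fin n → Fin n → PolyAlg n) :=
  { magicRelations_gen with star_eq := star_gen }

theorem map_star_lift {R : Type*} [Ring R] [StarRing R] [Algebra ℂ R] [StarModule ℂ R]
    (v : Fin n → Fin n → R) (hv : IsMagicUnitary v) (a : PolyAlg n) :
    lift v hv.toMagicRelations (star a) = star (lift v hv.toMagicRelations a) := by
  induction a using induction_on with
  | halg c => rw [star_algebraMap, AlgHom.commutes, AlgHom.commutes, algebraMap_star_comm]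
  | hgen i j => rw [star_gen, lift_gen, hv.star_eq]
  | hmul a b ha hb => rw [star_mul, map_mul, map_mul, ha, hb, star_mul]
  | hadd a b ha hb => rw [star_add, map_add, map_add, ha, hb, star_add]

theorem magicRelations_comul : MagicRelations
    (fun i j : Fin n => ∑ k, (gen i k : PolyAlg n) ⊗ₜ[ℂ] (gen k j : PolyAlg n)) := by
  have key : ∀ i j i' j' : Fin n,
      (∑ k, (gen i k : PolyAlg n) ⊗ₜ[ℂ] (gen k j : PolyAlg n)) *
        (∑ k, (gen i' k : PolyAlg n) ⊗ₜ[ℂ] (gen k j' : PolyAlg n)) =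
      ∑ k, ∑ l, ((gen i k : PolyAlg n) * gen i' l) ⊗ₜ[ℂ] ((gen k j : PolyAlg n) * gen l j') := by
    intro i j i' j'
    simp only [Finset.sum_mul_sum, Algebra.TensorProduct.tmul_mul_tmul]
  have diag : ∀ i j i' j' : Fin n, (i = i' ∨ j = j') →
      (∑ k, (gen i k : PolyAlg n) ⊗ₜ[ℂ] (gen k j : PolyAlg n)) *
        (∑ k, (gen i' k : PolyAlg n) ⊗ₜ[ℂ] (gen k j' : PolyAlg n)) =
      ∑ k, ((gen i k : PolyAlg n) * gen i' k) ⊗ₜ[ℂ] ((gen k j : PolyAlg n) * gen k j') := by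
    intro i j i' j' h
    rw [key]
    refine Finset.sum_congr rfl fun k _ => ?_
    refine Finset.sum_eq_single k (fun l _ hl => ?_) (by simp)
    rcases h with rfl | rfl
    · rw [magicRelations_gen.row_orth _ _ _ hl.symm, TensorProduct.zero_tmul]
    · rw [magicRelations_gen.col_orth _ _ _ hl.symm, TensorProduct.tmul_zero]
  refine ⟨fun i j => ?_, fun i k l h => ?_, fun i k l h => ?_, fun i => ?_, fun i => ?_⟩
  · rw [diag _ _ _ _ (Or.inl rfl)]
    simp only [magicRelations_gen.idem]
  · rw [diag _ _ _ _ (Or.inl rfl)]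
    simp only [magicRelations_gen.row_orth _ _ _ h, TensorProduct.tmul_zero,
      Finset.sum_const_zero]
  · rw [diag _ _ _ _ (Or.inr rfl)]
    simp only [magicRelations_gen.col_orth _ _ _ h, TensorProduct.zero_tmul,
      Finset.sum_const_zero]
  · rw [Finset.sum_comm]
    simp only [← TensorProduct.tmul_sum, magicRelations_gen.row_sum, ← TensorProduct.sum_tmul,
      Algebra.TensorProduct.one_def]
  · rw [Finset.sum_comm]
    simp only [← TensorProduct.sum_tmul, magicRelations_gen.col_sum, ← TensorProduct.tmul_sum,
      Algebra.TensorProduct.one_def]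

/-- The comultiplication `u i j ↦ ∑ k, u i k ⊗ u k j`. -/
def comul (n : ℕ) : PolyAlg n →ₐ[ℂ] PolyAlg n ⊗[ℂ] PolyAlg n :=
  lift (fun i j => ∑ k, gen i k ⊗ₜ[ℂ] gen k j) magicRelations_comul

/-- A `C*`-seminorm on the *-algebra of the quantum permutation group. -/
structure IsCStarSeminorm (p : Seminorm ℂ (PolyAlg n)) : Prop where
  mul_le : ∀ a b, p (a * b) ≤ p a * p b
  star_mul_self : ∀ a, p (star a * a) = p a * p a

theorem isCStarSeminorm_zero : IsCStarSeminorm (0 : Seminorm ℂ (PolyAlg n)) where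
  mul_le a b := by simp
  star_mul_self a := by simp

instance : Nonempty {p : Seminorm ℂ (PolyAlg n) // IsCStarSeminorm p} :=
  ⟨⟨0, isCStarSeminorm_zero⟩⟩

theorem IsCStarSeminorm.le_one {p : Seminorm ℂ (PolyAlg n)} (hp : IsCStarSeminorm p)
    {a : PolyAlg n} (h : star a * a = a) : p a ≤ 1 := by
  have h1 := hp.star_mul_self a
  rw [h] at h1
  nlinarith [apply_nonneg p a]

theorem exists_bound (a : PolyAlg n) :
    ∃ C : ℝ, ∀ p : Seminorm ℂ (PolyAlg n), IsCStarSeminorm p → p a ≤ C := by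
  induction a using induction_on with
  | halg c =>
    refine ⟨‖c‖, fun p hp => ?_⟩
    rw [Algebra.algebraMap_eq_smul_one, map_smul_eq_mul]
    exact mul_le_of_le_one_right (norm_nonneg c) (hp.le_one (by simp))
  | hgen i j =>
    exact ⟨1, fun p hp => hp.le_one (by rw [star_gen, magicRelations_gen.idem])⟩
  | hmul a b ha hb =>
    obtain ⟨C, hC⟩ := ha
    obtain ⟨D, hD⟩ := hb
    refine ⟨C * D, fun p hp => (hp.mul_le a b).trans ?_⟩
    exact mul_le_mul (hC p hp) (hD p hp) (apply_nonneg p b) ((apply_nonneg p a).trans (hC p hp))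
  | hadd a b ha hb =>
    obtain ⟨C, hC⟩ := ha
    obtain ⟨D, hD⟩ := hb
    exact ⟨C + D, fun p hp => (map_add_le_add p a b).trans (add_le_add (hC p hp) (hD p hp))⟩

/-- The universal `C*`-norm: the largest `C*`-seminorm. -/
def univNorm (a : PolyAlg n) : ℝ :=
  ⨆ p : {p : Seminorm ℂ (PolyAlg n) // IsCStarSeminorm p}, p.1 a

theorem le_univNorm {p : Seminorm ℂ (PolyAlg n)} (hp : IsCStarSeminorm p) (a : PolyAlg n) :
    p a ≤ univNorm a := by
  obtain ⟨C, hC⟩ := exists_bound a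
  exact le_ciSup (f := fun p : {p : Seminorm ℂ (PolyAlg n) // IsCStarSeminorm p} => p.1 a)
    ⟨C, by rintro _ ⟨q, rfl⟩; exact hC q.1 q.2⟩ ⟨p, hp⟩

theorem univNorm_nonneg (a : PolyAlg n) : 0 ≤ univNorm a :=
  (apply_nonneg (0 : Seminorm ℂ (PolyAlg n)) a).trans (le_univNorm isCStarSeminorm_zero a)

theorem univNorm_add_le (a b : PolyAlg n) : univNorm (a + b) ≤ univNorm a + univNorm b :=
  ciSup_le fun p => (map_add_le_add p.1 a b).trans
    (add_le_add (le_univNorm p.2 a) (le_univNorm p.2 b))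

theorem univNorm_mul_le (a b : PolyAlg n) : univNorm (a * b) ≤ univNorm a * univNorm b :=
  ciSup_le fun p => (p.2.mul_le a b).trans
    (mul_le_mul (le_univNorm p.2 a) (le_univNorm p.2 b) (apply_nonneg p.1 b) (univNorm_nonneg a))

theorem univNorm_smul (c : ℂ) (a : PolyAlg n) : univNorm (c • a) = ‖c‖ * univNorm a := by
  simp only [univNorm, map_smul_eq_mul]
  exact (Real.mul_iSup_of_nonneg (norm_nonneg c) _).symm

theorem univNorm_le_star_mul_self (a : PolyAlg n) :
    univNorm a * univNorm a ≤ univNorm (star a * a) := by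
  have h : univNorm a ≤ √(univNorm (star a * a)) := by
    refine ciSup_le fun p => Real.le_sqrt_of_sq_le ?_
    rw [sq, ← p.2.star_mul_self]
    exact le_univNorm p.2 _
  calc univNorm a * univNorm a
      ≤ √(univNorm (star a * a)) * √(univNorm (star a * a)) :=
        mul_le_mul h h (univNorm_nonneg a) (Real.sqrt_nonneg _)
    _ = univNorm (star a * a) := Real.mul_self_sqrt (univNorm_nonneg _)

theorem univNorm_star_le (a : PolyAlg n) : univNorm (star a) ≤ univNorm a := by
  have h1 := univNorm_le_star_mul_self (star a)
  rw [star_star] at h1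
  have h2 := h1.trans (univNorm_mul_le a (star a))
  rcases (univNorm_nonneg (star a)).eq_or_lt with h | h
  · rw [← h]; exact univNorm_nonneg a
  · exact le_of_mul_le_mul_right h2 h

theorem univNorm_star (a : PolyAlg n) : univNorm (star a) = univNorm a :=
  le_antisymm (univNorm_star_le a) (by simpa using univNorm_star_le (star a))

instance : SeminormedRing (PolyAlg n) :=
  { (inferInstance : Ring (PolyAlg n)),
    (AddGroupSeminorm.toSeminormedAddCommGroup
      { toFun := univNorm
        map_zero' := by simpa using univNorm_smul (0 : ℂ) (0 : PolyAlg n)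
        add_le' := univNorm_add_le
        neg' := fun a => by simpa using univNorm_smul (-1 : ℂ) a } :
      SeminormedAddCommGroup (PolyAlg n)) with
    norm_mul_le := univNorm_mul_le }

theorem norm_def (a : PolyAlg n) : ‖a‖ = univNorm a := rfl

instance : NormedAlgebra ℂ (PolyAlg n) where
  norm_smul_le c a := (univNorm_smul c a).le

instance : NormedStarGroup (PolyAlg n) where
  norm_star_le a := (univNorm_star a).le

end PolyAlg

/-- The quantum permutation group `A_s(n)`: the universal unital `C*`-algebra generated by the
entries of an `n × n` magic unitary, that is, the completion (and separation) of the universal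
*-algebra with respect to the largest `C*`-seminorm. -/
def QPerm (n : ℕ) : Type := UniformSpace.Completion (PolyAlg n)

namespace QPerm

open UniformSpace

variable {n : ℕ}

instance : NormedRing (QPerm n) := inferInstanceAs (NormedRing (Completion (PolyAlg n)))
instance : CompleteSpace (QPerm n) := inferInstanceAs (CompleteSpace (Completion (PolyAlg n)))
instance : Algebra ℂ (QPerm n) := inferInstanceAs (Algebra ℂ (Completion (PolyAlg n)))

instance : NormedAlgebra ℂ (QPerm n) where
  norm_smul_le c a := norm_smul_le (β := Completion (PolyAlg n)) c a

/-- The canonical map from the *-algebra to the `C*`-algebra. -/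
def ofPoly (n : ℕ) : PolyAlg n →ₐ[ℂ] QPerm n where
  toFun a := (a : Completion (PolyAlg n))
  map_one' := rfl
  map_mul' a b := Completion.coe_mul a b
  map_zero' := rfl
  map_add' a b := Completion.coe_add a b
  commutes' _ := rfl

theorem norm_ofPoly (a : PolyAlg n) : ‖ofPoly n a‖ = PolyAlg.univNorm a :=
  Completion.norm_coe a

theorem denseRange_ofPoly : DenseRange (ofPoly n) := Completion.denseRange_coe

theorem continuous_ofPoly : Continuous (ofPoly n) := Completion.continuous_coe _

instance : Star (QPerm n) where
  star := Completion.map (star : PolyAlg n → PolyAlg n)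

theorem star_ofPoly (a : PolyAlg n) : star (ofPoly n a) = ofPoly n (star a) :=
  Completion.map_coe (starₗᵢ ℂ : PolyAlg n ≃ₗᵢ⋆[ℂ] PolyAlg n).isometry.uniformContinuous a

instance : ContinuousStar (QPerm n) where
  continuous_star := Completion.continuous_map

theorem induction {P : QPerm n → Prop} (x : QPerm n) (hc : IsClosed {x | P x})
    (h : ∀ a, P (ofPoly n a)) : P x :=
  denseRange_ofPoly.induction_on x hc h

theorem induction₂ {P : QPerm n → QPerm n → Prop} (x y : QPerm n)
    (hc : IsClosed {z : QPerm n × QPerm n | P z.1 z.2})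
    (h : ∀ a b, P (ofPoly n a) (ofPoly n b)) : P x y :=
  denseRange_ofPoly.induction_on₂ hc h x y

instance : StarRing (QPerm n) where
  star_involutive x := by
    refine induction (P := fun x => star (star x) = x) x
      (isClosed_eq (by fun_prop) (by fun_prop)) fun a => ?_
    rw [star_ofPoly, star_ofPoly, star_star]
  star_mul x y := by
    refine induction₂ (P := fun x y => star (x * y) = star y * star x) x y
      (isClosed_eq (by fun_prop) (by fun_prop)) fun a b => ?_
    rw [← map_mul, star_ofPoly, star_ofPoly, star_ofPoly, star_mul, map_mul]
  star_add x y := by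
    refine induction₂ (P := fun x y => star (x + y) = star x + star y) x y
      (isClosed_eq (by fun_prop) (by fun_prop)) fun a b => ?_
    rw [← map_add, star_ofPoly, star_ofPoly, star_ofPoly, star_add, map_add]

instance : StarModule ℂ (QPerm n) where
  star_smul c x := by
    have h1 : Continuous fun x : QPerm n => c • x := continuous_const_smul c
    have h2 : Continuous fun x : QPerm n => star c • x := continuous_const_smul (star c)
    refine induction (P := fun x => star (c • x) = star c • star x) x
      (isClosed_eq (continuous_star.comp h1) (h2.comp continuous_star)) fun a => ?_
    have h3 : ∀ (d : ℂ) (b : PolyAlg n), ofPoly n (d • b) = d • ofPoly n b :=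
      fun d b => map_smul (ofPoly n) d b
    rw [← h3, star_ofPoly, star_ofPoly, star_smul, h3]

instance : CStarRing (QPerm n) where
  norm_mul_self_le x := by
    refine induction (P := fun x => ‖x‖ * ‖x‖ ≤ ‖star x * x‖) x
      (isClosed_le (by fun_prop) (by fun_prop)) fun a => ?_
    rw [star_ofPoly, ← map_mul, norm_ofPoly, norm_ofPoly]
    exact PolyAlg.univNorm_le_star_mul_self a

instance : CStarAlgebra (QPerm n) where

instance : PartialOrder (QPerm n) := CStarAlgebra.spectralOrder (QPerm n)
instance : StarOrderedRing (QPerm n) := CStarAlgebra.spectralOrderedRing (QPerm n)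

/-- The entries `u i j` of the defining matrix. -/
def u (i j : Fin n) : QPerm n := ofPoly n (PolyAlg.gen i j)

theorem isMagicUnitary_u : IsMagicUnitary (u : Fin n → Fin n → QPerm n) where
  idem i j := by simp only [u, ← map_mul, PolyAlg.magicRelations_gen.idem]
  row_orth i k l h := by
    simp only [u, ← map_mul, PolyAlg.magicRelations_gen.row_orth i k l h, map_zero]
  col_orth i k l h := by
    simp only [u, ← map_mul, PolyAlg.magicRelations_gen.col_orth i k l h, map_zero]
  row_sum i := by simp only [u, ← map_sum, PolyAlg.magicRelations_gen.row_sum, map_one]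
  col_sum i := by simp only [u, ← map_sum, PolyAlg.magicRelations_gen.col_sum, map_one]
  star_eq i j := by simp only [u, star_ofPoly, PolyAlg.star_gen]

/-- The universal property: every `n × n` magic unitary in a unital `C*`-algebra is the image of
the defining matrix under exactly one unital *-homomorphism. -/
theorem existsUnique_starAlgHom {B : Type*} [CStarAlgebra B] (v : Fin n → Fin n → B)
    (hv : IsMagicUnitary v) :
    ∃! f : QPerm n →⋆ₐ[ℂ] B, ∀ i j, f (u i j) = v i j := by
  have hbound : ∀ a, ‖PolyAlg.lift v hv.toMagicRelations a‖ ≤ ‖a‖ := by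
    intro a
    refine PolyAlg.le_univNorm
      (p := (normSeminorm ℂ B).comp (PolyAlg.lift v hv.toMagicRelations).toLinearMap)
      ⟨fun a b => ?_, fun a => ?_⟩ a
    · simpa using norm_mul_le _ _
    · simpa [PolyAlg.map_star_lift v hv] using CStarRing.norm_star_mul_self
  have hcont : Continuous (PolyAlg.lift v hv.toMagicRelations) :=
    AddMonoidHomClass.continuous_of_bound (PolyAlg.lift v hv.toMagicRelations) 1
      (by simpa using hbound)
  let g : QPerm n →+* B :=
    Completion.extensionHom (PolyAlg.lift v hv.toMagicRelations).toRingHom hcont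
  have hg : ∀ a, g (ofPoly n a) = PolyAlg.lift v hv.toMagicRelations a := fun a =>
    Completion.extensionHom_coe _ hcont a
  have hgc : Continuous g := Completion.continuous_extension
  let f : QPerm n →⋆ₐ[ℂ] B :=
    { g with
      commutes' := fun c => by
        have := hg (algebraMap ℂ _ c)
        rwa [AlgHom.commutes, AlgHom.commutes] at this
      map_star' := fun x => by
        change g (star x) = star (g x)
        refine induction (P := fun x => g (star x) = star (g x)) x
          (isClosed_eq (hgc.comp continuous_star) (continuous_star.comp hgc)) fun a => ?_
        rw [star_ofPoly, hg, hg, PolyAlg.map_star_lift v hv] }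
  refine ⟨f, fun i j => (hg _).trans (PolyAlg.lift_gen _ _ i j), fun f' hf' => ?_⟩
  have hf'c : Continuous f' :=
    AddMonoidHomClass.continuous_of_bound f' 1 fun a => by
      simpa using NonUnitalStarAlgHom.norm_apply_le f' a
  ext x
  change f' x = g x
  refine induction (P := fun x => f' x = g x) x (isClosed_eq hf'c hgc) fun a => ?_
  rw [hg]
  induction a using PolyAlg.induction_on with
  | halg c => rw [AlgHom.commutes, AlgHom.commutes]; exact AlgHomClass.commutes f' c
  | hgen i j => rw [PolyAlg.lift_gen]; exact hf' i j
  | hmul a b ha hb => rw [map_mul, map_mul, map_mul, ha, hb]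
  | hadd a b ha hb => rw [map_add, map_add, map_add, ha, hb]

/-- The slice map `id ⊗ ψ`. -/
def sliceRight (ψ : QPerm n →ₚ[ℂ] ℂ) : PolyAlg n ⊗[ℂ] PolyAlg n →ₗ[ℂ] QPerm n :=
  TensorProduct.lift (LinearMap.mk₂ ℂ (fun a b => ψ (ofPoly n b) • ofPoly n a)
    (fun _ _ _ => by simp) (fun _ _ _ => by simp [smul_smul, mul_comm])
    (fun _ _ _ => by simp [add_smul]) (fun _ _ _ => by simp [smul_smul]))

/-- The slice map `ψ ⊗ id`. -/
def sliceLeft (ψ : QPerm n →ₚ[ℂ] ℂ) : PolyAlg n ⊗[ℂ] PolyAlg n →ₗ[ℂ] QPerm n :=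
  TensorProduct.lift (LinearMap.mk₂ ℂ (fun a b => ψ (ofPoly n a) • ofPoly n b)
    (fun _ _ _ => by simp [add_smul]) (fun _ _ _ => by simp [smul_smul])
    (fun _ _ _ => by simp) (fun _ _ _ => by simp [smul_smul, mul_comm]))

/-- A Haar state: a state `ψ` on `A_s(n)` which is invariant under the comultiplication `Δ`,
`(id ⊗ ψ) ∘ Δ = ψ(·) 1 = (ψ ⊗ id) ∘ Δ` on the dense Hopf *-algebra. -/
structure IsHaarState (ψ : QPerm n →ₚ[ℂ] ℂ) : Prop where
  map_one : ψ 1 = 1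
  invariant_right : ∀ a : PolyAlg n,
    sliceRight ψ (PolyAlg.comul n a) = ψ (ofPoly n a) • (1 : QPerm n)
  invariant_left : ∀ a : PolyAlg n,
    sliceLeft ψ (PolyAlg.comul n a) = ψ (ofPoly n a) • (1 : QPerm n)

end QPerm

/-! ### Von Neumann algebras and `W*`-probability spaces -/

section VonNeumann

variable {H : Type*} [NormedAddCommGroup H] [InnerProductSpace ℂ H] [CompleteSpace H]

/-- The von Neumann algebra generated by a unital *-algebra of operators, i.e. its bicommutant. -/
def generatedVN (S : StarSubalgebra ℂ (H →L[ℂ] H)) : VonNeumannAlgebra H where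
  toStarSubalgebra :=
    StarSubalgebra.centralizer ℂ (StarSubalgebra.centralizer ℂ (S : Set (H →L[ℂ] H)) :
      Set (H →L[ℂ] H))
  centralizer_centralizer' := by simp

theorem le_generatedVN (S : StarSubalgebra ℂ (H →L[ℂ] H)) :
    S ≤ (generatedVN S).toStarSubalgebra := by
  intro a ha
  change a ∈ StarSubalgebra.centralizer ℂ (StarSubalgebra.centralizer ℂ (S : Set (H →L[ℂ] H)) :
      Set (H →L[ℂ] H))
  rw [← SetLike.mem_coe, StarSubalgebra.coe_centralizer_centralizer]
  exact Set.subset_centralizer_centralizer (Or.inl ha)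

/-- A linear functional on a von Neumann algebra is normal if it is `σ`-weakly continuous, i.e. of
the form `a ↦ ∑ k, ⟨ξ k, a (η k)⟩` with square summable sequences of vectors. -/
def IsNormalFunctional (M : VonNeumannAlgebra H) (φ : M.toStarSubalgebra →ₗ[ℂ] ℂ) : Prop :=
  ∃ ξ η : ℕ → H, Summable (fun k => ‖ξ k‖ ^ 2) ∧ Summable (fun k => ‖η k‖ ^ 2) ∧
    ∀ a : M.toStarSubalgebra,
      HasSum (fun k => ⟪ξ k, (a : H →L[ℂ] H) (η k)⟫_ℂ) (φ a)

/-- `(M, φ)` is a `W*`-probability space: `φ` is a faithful normal state on `M`. -/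
structure IsWStarProbabilitySpace (M : VonNeumannAlgebra H)
    (φ : M.toStarSubalgebra →ₗ[ℂ] ℂ) : Prop where
  map_one : φ 1 = 1
  nonneg : ∀ a, 0 ≤ φ (star a * a)
  faithful : ∀ a, φ (star a * a) = 0 → a = 0
  normal : IsNormalFunctional M φ

/-- `B` is a von Neumann subalgebra of `M` (with the same unit): regarded as a set of operators
on `H`, it is a von Neumann algebra. -/
def IsVonNeumannSubalgebra (M : VonNeumannAlgebra H)
    (B : Subalgebra ℂ M.toStarSubalgebra) : Prop :=
  ∃ N : VonNeumannAlgebra H, (N : Set (H →L[ℂ] H)) = Subtype.val '' (B : Set M.toStarSubalgebra)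

/-- The vector functional `a ↦ ⟨Ω, a Ω⟩` on a von Neumann algebra. -/
def vectorFunctional (M : VonNeumannAlgebra H) (Ω : H) : M.toStarSubalgebra →ₗ[ℂ] ℂ where
  toFun a := ⟪Ω, (a : H →L[ℂ] H) Ω⟫_ℂ
  map_add' a b := by simp
  map_smul' c a := by simp

end VonNeumann

/-! ### The GNS `W*`-probability space of a state on `A_s(n)` -/

section GNS

variable {n : ℕ} (ψ : QPerm n →ₚ[ℂ] ℂ)

/-- The cyclic vector: the class of `1` in the GNS Hilbert space. -/
def gnsVector : ψ.GNS := ((ψ.toPreGNS 1 : ψ.PreGNS) : UniformSpace.Completion ψ.PreGNS)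

/-- The von Neumann algebra generated by the image of `A_s(n)` in the GNS representation. -/
def gnsVN : VonNeumannAlgebra ψ.GNS := generatedVN ψ.gnsStarAlgHom.range

/-- The GNS representation, as a map into the von Neumann algebra which it generates. -/
def toGnsVN (a : QPerm n) : (gnsVN ψ).toStarSubalgebra :=
  ⟨ψ.gnsStarAlgHom a, le_generatedVN _ ⟨a, rfl⟩⟩

/-- The extension of the state `ψ` to the von Neumann algebra: the vector state of the cyclic
vector. -/
def gnsState : (gnsVN ψ).toStarSubalgebra →ₗ[ℂ] ℂ := vectorFunctional (gnsVN ψ) (gnsVector ψ)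

end GNS

/-! ### Noncommutative probability -/

section Probability

variable {A : Type*} [Ring A] [Algebra ℂ A]

/-- Quantum exchangeability of a finite sequence `x 1, …, x n` with respect to a functional `φ`:
for every `k ≤ n`, the joint distribution of `x 1, …, x k` is invariant under the action
`x i ↦ ∑ j, u i j ⊗ x j` of `A_s(k)`, that is,
`φ(x_{i(1)} ⋯ x_{i(m)}) 1 = ∑_{j(1), …, j(m)} φ(x_{j(1)} ⋯ x_{j(m)}) u_{i(1)j(1)} ⋯ u_{i(m)j(m)}`
in `A_s(k)` for all `m` and all `i(1), …, i(m)`. -/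
def QuantumExchangeable (φ : A →ₗ[ℂ] ℂ) {n : ℕ} (x : Fin n → A) : Prop :=
  ∀ (k : ℕ) (hk : k ≤ n) (m : ℕ) (i : Fin m → Fin k),
    φ (List.ofFn fun r => x (Fin.castLE hk (i r))).prod • (1 : QPerm k) =
      ∑ j : Fin m → Fin k, φ (List.ofFn fun r => x (Fin.castLE hk (j r))).prod •
        (List.ofFn fun r => QPerm.u (i r) (j r)).prod

/-- A conditional expectation from `A` onto a unital subalgebra `B`. -/
structure IsConditionalExpectation (B : Subalgebra ℂ A) (E : A →ₗ[ℂ] B) : Prop where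
  apply_coe : ∀ b : B, E b = b
  bimodule : ∀ (b₁ b₂ : B) (a : A), E (b₁ * a * b₂) = b₁ * E a * b₂

/-- The relations which turn the free algebra on the symbols `some b`, for `b : B`, and on
`none`, which stands for `X`, into the algebra of `B`-valued polynomials. -/
inductive BPolyRel (B : Type*) [Ring B] [Algebra ℂ B] :
    FreeAlgebra ℂ (Option B) → FreeAlgebra ℂ (Option B) → Prop
  | add (b c : B) : BPolyRel B (FreeAlgebra.ι ℂ (some (b + c)))
      (FreeAlgebra.ι ℂ (some b) + FreeAlgebra.ι ℂ (some c))
  | mul (b c : B) : BPolyRel B (FreeAlgebra.ι ℂ (some (b * c)))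
      (FreeAlgebra.ι ℂ (some b) * FreeAlgebra.ι ℂ (some c))
  | scalar (r : ℂ) : BPolyRel B (FreeAlgebra.ι ℂ (some (algebraMap ℂ B r)))
      (algebraMap ℂ (FreeAlgebra ℂ (Option B)) r)

/-- The algebra `B⟨X⟩` of `B`-valued polynomials: linear combinations of the words
`b₀ X b₁ X ⋯ X bₙ`, where `X` does not commute with the elements of `B`, i.e. the algebra freely
generated by the unital algebra `B` and the variable `X`. -/
abbrev BPoly (B : Type*) [Ring B] [Algebra ℂ B] : Type _ := RingQuot (BPolyRel B)

/-- The evaluation `p ↦ p(a)` of `B`-valued polynomials at an element `a` of an algebra `A`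
which contains `B`. -/
def BPoly.eval (B : Subalgebra ℂ A) (a : A) : BPoly B →ₐ[ℂ] A :=
  RingQuot.liftAlgHom ℂ
    ⟨FreeAlgebra.lift ℂ fun o : Option B => o.elim a (fun b => (b : A)), by
      intro p q h
      induction h with
      | add b c => simp
      | mul b c => simp
      | scalar r => simp⟩

/-- The elements `x i` are identically distributed with respect to `E`. -/
def IdenticallyDistributed (B : Subalgebra ℂ A) (E : A →ₗ[ℂ] B) {I : Type*} (x : I → A) :
    Prop :=
  ∀ (p : BPoly B) (i j : I), E (BPoly.eval B (x i) p) = E (BPoly.eval B (x j) p)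

/-- The elements `x i` are free with respect to `E` (free with amalgamation over `B`). The words
have length `m + 1 ≥ 1`, and neighbouring indices in a word are different. -/
def FreeWithAmalgamation (B : Subalgebra ℂ A) (E : A →ₗ[ℂ] B) {I : Type*} (x : I → A) :
    Prop :=
  ∀ (m : ℕ) (i : Fin (m + 1) → I) (p : Fin (m + 1) → BPoly B),
    (∀ r : Fin m, i r.castSucc ≠ i r.succ) →
    (∀ r, E (BPoly.eval B (x (i r)) (p r)) = 0) →
    E (List.ofFn fun r => BPoly.eval B (x (i r)) (p r)).prod = 0

end Probability

end QuantumDeFinetti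

end

/-!
The Haar state is constructed on the dense *-algebra. For a state `φ` there, let `T_φ` be the
operator on `(ℂ ^ n) ^ ⊗ m` with entries `φ (u_{i(1)j(1)} ⋯ u_{i(m)j(m)})` (`PolyAlg.levelOp`).
It is a contraction, since the tensor powers of `u` are isometries, and convolution of states is
multiplication of these operators. Positivity of convolutions is the Schur product theorem. As the
set of states is compact, Cesàro means of convolution powers give for each `φ` a state `h` with
`φ * h = h`. If `φ` is an average of finitely many states, strict convexity of the Hilbert space
ball shows that `h` absorbs each of these, so by the finite intersection property some state
absorbs all states from the left (`PolyAlg.exists_state_conv_eq`). A contraction and its adjoint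
have the same fixed vectors, which gives absorption from the right
(`PolyAlg.IsState.comp_conv_eq`). Finally, states on the dense *-algebra extend to `A_s(n)`
(`PolyAlg.IsState.exists_extension`), and states separate the points of a `C*`-algebra
(`eq_zero_of_forall_state`), so that absorption is invariance in `A_s(n)`. Uniqueness holds because
two Haar states both equal their convolution product.

The vector state on the generated von Neumann algebra is faithful because the Haar state is a
trace: right multiplications are then bounded on the GNS space, and they commute with the von
Neumann algebra and move the cyclic vector to a dense set. For the trace property let `T` be the
operator of the Haar state and `R` the cyclic rotation of the tensor factors. By invariance the
columns and the rows of `T` are fixed by the tensor power of `u`, and rotations preserve fixed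
vectors, by the magic relations alone (`MagicRelations.sum_mul_right_of_sum_mul_left`). Hence
`R T = T R T = T R`, which says that `ψ (u_{ac} w) = ψ (w u_{ac})` for all words `w`.

Quantum exchangeability of a column for `k = n` is invariance of the Haar state, and for `k < n` it
follows by applying the homomorphism `A_s(n) → A_s(k)` given by the magic unitary `diag (u, 1)`.

Freeness fails because the entries of a column form a partition of unity: if they are identically
distributed then `E[x_i] = 1 / n`, so freeness would force
`0 = E[(x_1 - 1 / n) (x_2 - 1 / n)] = -1 / n ^ 2`.
-/

open scoped TensorProduct ComplexOrder InnerProductSpace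

noncomputable section

namespace QuantumDeFinetti

/-! ### States separate the points of a `C*`-algebra -/

section Separation

variable {A : Type*} [CStarAlgebra A] [PartialOrder A] [StarOrderedRing A]

/-- The complex linear functional which agrees on the self-adjoint elements with a given real
linear functional. It is positive if the latter is nonnegative on positive elements. -/
def complexify (f : A →L[ℝ] ℝ) (hf : ∀ a, 0 ≤ a → 0 ≤ f a) : A →ₚ[ℂ] ℂ :=
  PositiveLinearMap.mk₀
    { toFun := fun a => (f (realPart a : A) : ℂ) + Complex.I * (f (imaginaryPart a : A) : ℂ)
      map_add' := fun a b => by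
        simp only [map_add, AddSubgroup.coe_add, Complex.ofReal_add]
        ring
      map_smul' := fun c a => by
        simp only [realPart_smul, imaginaryPart_smul, AddSubgroupClass.coe_sub,
          AddSubgroup.coe_add, selfAdjoint.val_smul, map_sub, map_add, map_smul, smul_eq_mul,
          Complex.ofReal_sub, Complex.ofReal_add, Complex.ofReal_mul, RingHom.id_apply]
        conv_rhs => rw [← Complex.re_add_im c]
        linear_combination (-(c.im : ℂ) * (f (imaginaryPart a : A) : ℂ)) * Complex.I_sq }
    (fun a ha => by
      have hs : IsSelfAdjoint a := .of_nonneg ha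
      change 0 ≤ (f (realPart a : A) : ℂ) + Complex.I * (f (imaginaryPart a : A) : ℂ)
      rw [hs.coe_realPart, hs.imaginaryPart]
      simpa using hf a ha)

theorem complexify_apply_of_isSelfAdjoint (f : A →L[ℝ] ℝ) (hf : ∀ a, 0 ≤ a → 0 ≤ f a) {a : A}
    (ha : IsSelfAdjoint a) : complexify f hf a = f a := by
  change (f (realPart a : A) : ℂ) + Complex.I * (f (imaginaryPart a : A) : ℂ) = f a
  rw [ha.coe_realPart, ha.imaginaryPart]
  simp

/-- Hahn–Banach separation of a point from the closed cone of positive elements. -/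
theorem nonneg_of_forall_state {a : A} (ha : IsSelfAdjoint a)
    (h : ∀ φ : A →ₚ[ℂ] ℂ, φ 1 = 1 → 0 ≤ φ a) : 0 ≤ a := by
  by_contra hneg
  obtain ⟨f, hf, hfa⟩ := (ProperCone.positive ℝ A).hyperplane_separation_point
    (x₀ := a) (by simpa using hneg)
  -- `f 1 > 0`, since `0 ≤ f (‖a‖ + a) = ‖a‖ * f 1 + f a`
  have h1 : 0 < f 1 := by
    have h2 : 0 ≤ algebraMap ℝ A ‖a‖ + a := by
      rw [← sub_neg_eq_add, sub_nonneg]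
      simpa using IsSelfAdjoint.le_algebraMap_norm_self ha.neg
    have h3 := hf _ h2
    rw [map_add, Algebra.algebraMap_eq_smul_one, map_smul, smul_eq_mul] at h3
    by_contra h4
    nlinarith [norm_nonneg a]
  have hg : ∀ b, 0 ≤ b → 0 ≤ ((f 1)⁻¹ • f) b := fun b hb =>
    mul_nonneg (inv_nonneg.2 h1.le) (hf b (by simpa using hb))
  have h5 := h (complexify _ hg) (by
    rw [complexify_apply_of_isSelfAdjoint _ _ (.one A)]
    simp [h1.ne'])
  rw [complexify_apply_of_isSelfAdjoint _ _ ha, Complex.zero_le_real] at h5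
  exact absurd h5 (not_le.2 (mul_neg_of_pos_of_neg (inv_pos.2 h1) hfa))

theorem eq_zero_of_forall_state {a : A} (h : ∀ φ : A →ₚ[ℂ] ℂ, φ 1 = 1 → φ a = 0) : a = 0 := by
  have key : ∀ b : A, IsSelfAdjoint b → (∀ φ : A →ₚ[ℂ] ℂ, φ 1 = 1 → φ b = 0) → b = 0 := by
    intro b hb hφ
    refine le_antisymm ?_ (nonneg_of_forall_state hb fun φ h1 => (hφ φ h1).ge)
    refine neg_nonneg.1 (nonneg_of_forall_state hb.neg fun φ h1 => ?_)
    rw [map_neg, hφ φ h1, neg_zero]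
  have hstar : ∀ φ : A →ₚ[ℂ] ℂ, φ 1 = 1 → φ (star a) = 0 := fun φ h1 => by
    rw [map_star, h φ h1, star_zero]
  have hre : (realPart a : A) = 0 := key _ (realPart a).2 fun φ h1 => by
    rw [realPart_apply_coe, ← Complex.coe_smul, map_smul, map_add, h φ h1, hstar φ h1, add_zero,
      smul_zero]
  have him : (imaginaryPart a : A) = 0 := key _ (imaginaryPart a).2 fun φ h1 => by
    rw [imaginaryPart_apply_coe, ← Complex.coe_smul, map_smul, map_smul, map_sub, h φ h1,
      hstar φ h1, sub_zero, smul_zero, smul_zero]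
  rw [← realPart_add_I_smul_imaginaryPart a, hre, him, smul_zero, add_zero]

end Separation

/-! ### States on the dense *-algebra -/

namespace PolyAlg

variable {n : ℕ}

/-- A state on the dense *-algebra: a linear functional which maps `1` to `1` and is nonnegative
on the elements `a* a`. No continuity is required; it is automatic, since the generators are
projections. -/
structure IsState (φ : PolyAlg n →ₗ[ℂ] ℂ) : Prop where
  map_one : φ 1 = 1
  nonneg : ∀ a, 0 ≤ φ (star a * a)

namespace IsState

variable {φ : PolyAlg n →ₗ[ℂ] ℂ}

theorem nonneg_add_smul (hφ : IsState φ) (a : PolyAlg n) (c : ℂ) :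
    0 ≤ φ (star a * a) + (c * φ (star a) + star c * φ a) + star c * c := by
  have h := hφ.nonneg (a + c • 1)
  have e : star (a + c • 1) * (a + c • 1) =
      star a * a + (c • star a + star c • a) + (star c * c) • (1 : PolyAlg n) := by
    simp only [star_add, star_smul, star_one, add_mul, mul_add, smul_mul_assoc, mul_smul_comm,
      one_mul, mul_one, smul_add, mul_smul, smul_comm c (star c)]
    abel
  rw [e] at h
  simpa only [map_add, map_smul, hφ.map_one, smul_eq_mul, mul_one] using h

theorem map_star (hφ : IsState φ) (a : PolyAlg n) : φ (star a) = star (φ a) := by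
  have h0 := (Complex.nonneg_iff.1 (hφ.nonneg a)).2
  have h1 := (Complex.nonneg_iff.1 (hφ.nonneg_add_smul a 1)).2
  have h2 := (Complex.nonneg_iff.1 (hφ.nonneg_add_smul a Complex.I)).2
  simp at h1 h2
  apply Complex.ext <;> simp <;> linarith

/-- The Cauchy–Schwarz inequality. -/
theorem norm_sq_le (hφ : IsState φ) (a : PolyAlg n) : ‖φ a‖ ^ 2 ≤ (φ (star a * a)).re := by
  have h := (Complex.nonneg_iff.1 (hφ.nonneg_add_smul a (-φ a))).1
  rw [hφ.map_star] at h
  rw [Complex.sq_norm, Complex.normSq_apply]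
  simp at h
  nlinarith

end IsState

/-- The pre-Hilbert space of a state on the dense *-algebra: the algebra itself with the
semi-inner product `⟪a, b⟫ = φ (a* b)`. -/
def PreHilbert (φ : PolyAlg n →ₗ[ℂ] ℂ) (_ : IsState φ) : Type := PolyAlg n

namespace PreHilbert

variable {φ : PolyAlg n →ₗ[ℂ] ℂ} (hφ : IsState φ)

instance : AddCommGroup (PreHilbert φ hφ) := inferInstanceAs (AddCommGroup (PolyAlg n))
instance : Module ℂ (PreHilbert φ hφ) := inferInstanceAs (Module ℂ (PolyAlg n))

/-- The identification of the algebra with the pre-Hilbert space. -/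
def of : PolyAlg n ≃ₗ[ℂ] PreHilbert φ hφ := LinearEquiv.refl ℂ _

/-- The semi-inner product. -/
abbrev core : PreInnerProductSpace.Core ℂ (PreHilbert φ hφ) where
  inner a b := φ (star ((of hφ).symm a) * (of hφ).symm b)
  conj_inner_symm a b := by
    rw [← Complex.star_def, ← hφ.map_star, star_mul, star_star]
  re_inner_nonneg a := (Complex.nonneg_iff.1 (hφ.nonneg _)).1
  add_left _ _ _ := by rw [map_add, star_add, add_mul, map_add]
  smul_left a b c := by
    rw [map_smul, star_smul, smul_mul_assoc, map_smul, smul_eq_mul, Complex.star_def]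

instance : SeminormedAddCommGroup (PreHilbert φ hφ) :=
  InnerProductSpace.Core.toSeminormedAddCommGroup (c := core hφ)
instance : InnerProductSpace ℂ (PreHilbert φ hφ) := InnerProductSpace.ofCore (core hφ)

theorem inner_of (a b : PolyAlg n) : ⟪of hφ a, of hφ b⟫_ℂ = φ (star a * b) := rfl

theorem norm_sq_of (a : PolyAlg n) : ‖of hφ a‖ ^ 2 = (φ (star a * a)).re := by
  rw [← inner_of hφ, ← inner_self_eq_norm_sq (𝕜 := ℂ)]
  rfl

/-- Left multiplication by a polynomial in projections is bounded. -/
theorem exists_bound_mul (a : PolyAlg n) :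
    ∃ C : ℝ, ∀ b, ‖of hφ (a * b)‖ ≤ C * ‖of hφ b‖ := by
  induction a using PolyAlg.induction_on with
  | halg c =>
    refine ⟨‖c‖, fun b => ?_⟩
    rw [← Algebra.smul_def, map_smul, norm_smul]
  | hgen i j =>
    refine ⟨1, fun b => ?_⟩
    rw [one_mul, ← sq_le_sq₀ (norm_nonneg _) (norm_nonneg _), norm_sq_of, norm_sq_of]
    have h := (Complex.nonneg_iff.1 (hφ.nonneg ((1 - gen i j) * b))).1
    -- `u` is a projection, so `b* b = (u b)* (u b) + ((1 - u) b)* ((1 - u) b)`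
    have e : star b * b = star (gen i j * b) * (gen i j * b) +
        star ((1 - gen i j) * b) * ((1 - gen i j) * b) := by
      have hu := (magicRelations_gen (n := n)).idem i j
      have h1 : star (gen i j * b) * (gen i j * b) = star b * (gen i j * gen i j) * b := by
        rw [star_mul, star_gen]; noncomm_ring
      have h2 : star ((1 - gen i j) * b) * ((1 - gen i j) * b) =
          star b * b - star b * gen i j * b - star b * gen i j * b +
            star b * (gen i j * gen i j) * b := by
        rw [star_mul, star_sub, star_one, star_gen]; noncomm_ring
      rw [h1, h2, hu]; abel
    rw [e, map_add, Complex.add_re]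
    linarith
  | hmul a b ha hb =>
    obtain ⟨C, hC⟩ := ha
    obtain ⟨D, hD⟩ := hb
    refine ⟨|C| * D, fun x => ?_⟩
    rw [mul_assoc, mul_assoc]
    refine (hC _).trans ((mul_le_mul_of_nonneg_right (le_abs_self C) (norm_nonneg _)).trans ?_)
    exact mul_le_mul_of_nonneg_left (hD x) (abs_nonneg C)
  | hadd a b ha hb =>
    obtain ⟨C, hC⟩ := ha
    obtain ⟨D, hD⟩ := hb
    refine ⟨C + D, fun x => ?_⟩
    rw [add_mul, add_mul, map_add]
    exact (norm_add_le _ _).trans (add_le_add (hC x) (hD x))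

/-- Left multiplication as a bounded operator on the pre-Hilbert space. -/
def leftMul : PolyAlg n →ₗ[ℂ] PreHilbert φ hφ →L[ℂ] PreHilbert φ hφ where
  toFun a := LinearMap.mkContinuousOfExistsBound
    ((of hφ).toLinearMap ∘ₗ LinearMap.mulLeft ℂ a ∘ₗ (of hφ).symm.toLinearMap)
    (exists_bound_mul hφ a)
  map_add' a b := ContinuousLinearMap.ext fun x => add_mul a b ((of hφ).symm x)
  map_smul' c a := ContinuousLinearMap.ext fun x => smul_mul_assoc c a ((of hφ).symm x)

theorem leftMul_of (a b : PolyAlg n) : leftMul hφ a (of hφ b) = of hφ (a * b) := rfl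

theorem leftMul_mul (a b : PolyAlg n) : leftMul hφ (a * b) = leftMul hφ a * leftMul hφ b :=
  ContinuousLinearMap.ext fun x => congrArg (of hφ) (mul_assoc a b ((of hφ).symm x))

theorem norm_leftMul_mul_self_le (a : PolyAlg n) :
    ‖leftMul hφ a‖ * ‖leftMul hφ a‖ ≤ ‖leftMul hφ (star a * a)‖ := by
  have h : ‖leftMul hφ a‖ ≤ √‖leftMul hφ (star a * a)‖ := by
    refine ContinuousLinearMap.opNorm_le_bound _ (Real.sqrt_nonneg _) fun x => ?_
    obtain ⟨b, rfl⟩ := (of hφ).surjective x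
    refine (sq_le_sq₀ (norm_nonneg _) (by positivity)).1 ?_
    rw [mul_pow, Real.sq_sqrt (ContinuousLinearMap.opNorm_nonneg _), leftMul_of, norm_sq_of]
    have e : star (a * b) * (a * b) = star b * (star a * a * b) := by
      rw [star_mul]; noncomm_ring
    rw [e, ← inner_of hφ, ← leftMul_of]
    calc (⟪of hφ b, leftMul hφ (star a * a) (of hφ b)⟫_ℂ).re
        ≤ ‖of hφ b‖ * ‖leftMul hφ (star a * a) (of hφ b)‖ := re_inner_le_norm (𝕜 := ℂ) _ _
      _ ≤ ‖of hφ b‖ * (‖leftMul hφ (star a * a)‖ * ‖of hφ b‖) := by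
          gcongr; exact ContinuousLinearMap.le_opNorm _ _
      _ = ‖leftMul hφ (star a * a)‖ * ‖of hφ b‖ ^ 2 := by ring
  calc ‖leftMul hφ a‖ * ‖leftMul hφ a‖
      ≤ √‖leftMul hφ (star a * a)‖ * √‖leftMul hφ (star a * a)‖ := by gcongr
    _ = _ := Real.mul_self_sqrt (ContinuousLinearMap.opNorm_nonneg _)

theorem norm_leftMul_mul_le (a b : PolyAlg n) :
    ‖leftMul hφ (a * b)‖ ≤ ‖leftMul hφ a‖ * ‖leftMul hφ b‖ := by
  rw [leftMul_mul]
  exact ContinuousLinearMap.opNorm_comp_le _ _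

theorem norm_leftMul_star_le (a : PolyAlg n) : ‖leftMul hφ (star a)‖ ≤ ‖leftMul hφ a‖ := by
  have h1 := norm_leftMul_mul_self_le hφ (star a)
  rw [star_star] at h1
  have h2 := h1.trans (norm_leftMul_mul_le hφ a (star a))
  rcases (leftMul hφ (star a)).opNorm_nonneg.eq_or_lt with h | h
  · rw [← h]; exact ContinuousLinearMap.opNorm_nonneg _
  · exact le_of_mul_le_mul_right h2 h

theorem isCStarSeminorm :
    IsCStarSeminorm ((normSeminorm ℂ (PreHilbert φ hφ →L[ℂ] PreHilbert φ hφ)).comp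
      (leftMul hφ)) where
  mul_le a b := norm_leftMul_mul_le hφ a b
  star_mul_self a := le_antisymm
    ((norm_leftMul_mul_le hφ _ a).trans
      (mul_le_mul_of_nonneg_right (norm_leftMul_star_le hφ a)
        (ContinuousLinearMap.opNorm_nonneg _)))
    (norm_leftMul_mul_self_le hφ a)

end PreHilbert

/-- States are contractive with respect to the universal `C*`-norm. -/
theorem IsState.norm_apply_le {φ : PolyAlg n →ₗ[ℂ] ℂ} (hφ : IsState φ) (a : PolyAlg n) :
    ‖φ a‖ ≤ ‖a‖ := by
  refine le_trans ?_ (le_univNorm (PreHilbert.isCStarSeminorm hφ) a)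
  change _ ≤ ‖PreHilbert.leftMul hφ a‖
  have h1 : ‖PreHilbert.of hφ 1‖ = 1 := by
    have h := PreHilbert.norm_sq_of hφ 1
    rw [star_one, mul_one, hφ.map_one, Complex.one_re] at h
    exact (pow_eq_one_iff_of_nonneg (norm_nonneg _) two_ne_zero).1 h
  have h2 : φ a = ⟪PreHilbert.of hφ 1, PreHilbert.leftMul hφ a (PreHilbert.of hφ 1)⟫_ℂ := by
    rw [PreHilbert.leftMul_of, PreHilbert.inner_of, star_one, one_mul, mul_one]
  rw [h2]
  refine (norm_inner_le_norm _ _).trans ?_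
  rw [h1, one_mul]
  simpa [h1] using (PreHilbert.leftMul hφ a).le_opNorm (PreHilbert.of hφ 1)

/-- Every state on the dense *-algebra extends to the `C*`-algebra. -/
theorem IsState.exists_extension {φ : PolyAlg n →ₗ[ℂ] ℂ} (hφ : IsState φ) :
    ∃ ψ : QPerm n →ₚ[ℂ] ℂ, ∀ a, ψ (QPerm.ofPoly n a) = φ a := by
  let f : PolyAlg n →L[ℂ] ℂ := φ.mkContinuous 1 fun a => by simpa using hφ.norm_apply_le a
  let e : PolyAlg n →L[ℂ] QPerm n := ⟨(QPerm.ofPoly n).toLinearMap, QPerm.continuous_ofPoly⟩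
  have he : ∀ a, f.extend e (e a) = f a := fun a =>
    f.extend_eq QPerm.denseRange_ofPoly
      (UniformSpace.Completion.isUniformInducing_coe (PolyAlg n)) a
  refine ⟨PositiveLinearMap.mk₀ (f.extend e).toLinearMap fun x hx => ?_, he⟩
  obtain ⟨y, rfl⟩ := CStarAlgebra.nonneg_iff_eq_star_mul_self.1 hx
  change 0 ≤ f.extend e (star y * y)
  refine QPerm.induction (P := fun y => 0 ≤ f.extend e (star y * y)) y
    (isClosed_le continuous_const ((f.extend e).continuous.comp (by fun_prop))) fun a => ?_
  rw [QPerm.star_ofPoly, ← map_mul]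
  exact (hφ.nonneg a).trans_eq (he _).symm

end PolyAlg

/-- The restriction of a state of the `C*`-algebra to the dense *-algebra. -/
theorem isState_comp_ofPoly {n : ℕ} (ψ : QPerm n →ₚ[ℂ] ℂ) (h1 : ψ 1 = 1) :
    PolyAlg.IsState (ψ.toLinearMap ∘ₗ (QPerm.ofPoly n).toLinearMap) where
  map_one := by simpa using h1
  nonneg a := by
    have h := ψ.map_nonneg (star_mul_self_nonneg (QPerm.ofPoly n a))
    rwa [QPerm.star_ofPoly, ← map_mul] at h

/-! ### Words in the entries of a magic unitary -/

section Word

variable {n m : ℕ} {R : Type*}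

theorem sum_fin_succ_pi {M : Type*} [AddCommMonoid M] (f : (Fin (m + 1) → Fin n) → M) :
    ∑ k, f k = ∑ a, ∑ k, f (Fin.cons a k) := by
  rw [← (Fin.consEquiv fun _ : Fin (m + 1) => Fin n).sum_comp, Fintype.sum_prod_type]
  rfl

theorem sum_fin_succ_pi_snoc {M : Type*} [AddCommMonoid M] (f : (Fin (m + 1) → Fin n) → M) :
    ∑ k, f k = ∑ a, ∑ k : Fin m → Fin n, f (Fin.snoc k a) := by
  rw [← (Fin.snocEquiv fun _ : Fin (m + 1) => Fin n).sum_comp, Fintype.sum_prod_type]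
  rfl

theorem prod_ofFn_sum [Semiring R] (f : Fin m → Fin n → R) :
    (List.ofFn fun r => ∑ k, f r k).prod =
      ∑ k : Fin m → Fin n, (List.ofFn fun r => f r (k r)).prod :=
  (MultilinearMap.mkPiAlgebraFin ℕ m R).map_sum f

/-- The word `v (i 0) (j 0) * v (i 1) (j 1) * ⋯` in the entries of a matrix. For the fundamental
matrix `u`, these are the entries of its `m`-fold tensor power. -/
def word [Monoid R] (v : Fin n → Fin n → R) (i j : Fin m → Fin n) : R :=
  (List.ofFn fun r => v (i r) (j r)).prod

@[simp]
theorem word_zero [Monoid R] (v : Fin n → Fin n → R) (i j : Fin 0 → Fin n) : word v i j = 1 := by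
  simp [word]

theorem word_cons [Monoid R] (v : Fin n → Fin n → R) (a b : Fin n) (i j : Fin m → Fin n) :
    word v (Fin.cons a i : Fin (m + 1) → Fin n) (Fin.cons b j : Fin (m + 1) → Fin n) =
      v a b * word v i j := by
  simp [word, List.ofFn_succ]

theorem word_snoc [Monoid R] (v : Fin n → Fin n → R) (a b : Fin n) (i j : Fin m → Fin n) :
    word v (Fin.snoc i a : Fin (m + 1) → Fin n) (Fin.snoc j b : Fin (m + 1) → Fin n) =
      word v i j * v a b := by
  simp only [word, List.ofFn_succ', Fin.snoc_castSucc, Fin.snoc_last, List.concat_eq_append,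
    List.prod_append, List.prod_singleton]

theorem map_word {S F : Type*} [Monoid R] [Monoid S] [FunLike F R S] [MonoidHomClass F R S]
    (f : F) (v : Fin n → Fin n → R) (i j : Fin m → Fin n) :
    f (word v i j) = word (fun a b => f (v a b)) i j := by
  rw [word, word, map_list_prod, List.map_ofFn]
  rfl

/-- The tensor powers of a magic unitary are isometries. -/
theorem IsMagicUnitary.sum_star_word_mul_word [Ring R] [StarRing R] {v : Fin n → Fin n → R}
    (hv : IsMagicUnitary v) (i j : Fin m → Fin n) :
    ∑ k, star (word v k i) * word v k j = if i = j then 1 else 0 := by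
  induction m with
  | zero => simp [Subsingleton.elim i j]
  | succ m ih =>
    obtain ⟨a, i, rfl⟩ : ∃ a i', i = (Fin.cons a i' : Fin (m + 1) → Fin n) :=
      ⟨i 0, Fin.tail i, (Fin.cons_self_tail i).symm⟩
    obtain ⟨b, j, rfl⟩ : ∃ b j', j = (Fin.cons b j' : Fin (m + 1) → Fin n) :=
      ⟨j 0, Fin.tail j, (Fin.cons_self_tail j).symm⟩
    have h1 : ∀ c k, star (word v (Fin.cons c k : Fin (m + 1) → Fin n) (Fin.cons a i)) *
        word v (Fin.cons c k : Fin (m + 1) → Fin n) (Fin.cons b j) =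
        star (word v k i) * (v c a * v c b) * word v k j := fun c k => by
      rw [word_cons, word_cons, star_mul, hv.star_eq]
      noncomm_ring
    simp_rw [sum_fin_succ_pi, h1]
    rw [Finset.sum_comm]
    simp_rw [← Finset.sum_mul, ← Finset.mul_sum]
    by_cases hab : a = b
    · subst hab
      simp [hv.idem, hv.col_sum, ih, Fin.cons_inj]
    · simp [hv.row_orth _ _ _ hab, hab, Fin.cons_inj]

end Word

namespace PolyAlg

variable {n m : ℕ}

theorem mem_span_word (a : PolyAlg n) :
    a ∈ Submodule.span ℂ {w | ∃ (m : ℕ) (i j : Fin m → Fin n), word gen i j = w} := by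
  set S := Submodule.span ℂ
    {w : PolyAlg n | ∃ (m : ℕ) (i j : Fin m → Fin n), word gen i j = w} with hS
  suffices h : ∀ b ∈ S, a * b ∈ S by
    rw [← mul_one a]
    exact h 1 (Submodule.subset_span ⟨0, Fin.elim0, Fin.elim0, word_zero _ _ _⟩)
  induction a using PolyAlg.induction_on with
  | halg c =>
    intro b hb
    rw [← Algebra.smul_def]
    exact S.smul_mem c hb
  | hgen a c =>
    intro b hb
    induction hb using Submodule.span_induction with
    | mem x hx =>
      obtain ⟨m, i, j, rfl⟩ := hx
      rw [← word_cons]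
      exact Submodule.subset_span ⟨m + 1, _, _, rfl⟩
    | zero => rw [mul_zero]; exact S.zero_mem
    | add x y _ _ hx hy => rw [mul_add]; exact S.add_mem hx hy
    | smul c x _ hx => rw [mul_smul_comm]; exact S.smul_mem c hx
  | hmul x y hx hy =>
    intro b hb
    rw [mul_assoc]
    exact hx _ (hy b hb)
  | hadd x y hx hy =>
    intro b hb
    rw [add_mul]
    exact S.add_mem (hx b hb) (hy b hb)

theorem linearMap_ext {M : Type*} [AddCommMonoid M] [Module ℂ M] {f g : PolyAlg n →ₗ[ℂ] M}
    (h : ∀ (m : ℕ) (i j : Fin m → Fin n), f (word gen i j) = g (word gen i j)) : f = g := by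
  ext a
  induction mem_span_word a using Submodule.span_induction with
  | mem x hx => obtain ⟨m, i, j, rfl⟩ := hx; exact h m i j
  | zero => rw [map_zero, map_zero]
  | add x y _ _ hx hy => rw [map_add, map_add, hx, hy]
  | smul c x _ hx => rw [map_smul, map_smul, hx]

theorem prod_ofFn_tmul (f g : Fin m → PolyAlg n) :
    (List.ofFn fun r => f r ⊗ₜ[ℂ] g r).prod = (List.ofFn f).prod ⊗ₜ[ℂ] (List.ofFn g).prod := by
  induction m with
  | zero => simp [Algebra.TensorProduct.one_def]
  | succ m ih =>
    simp only [List.ofFn_succ, List.prod_cons]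
    rw [ih, Algebra.TensorProduct.tmul_mul_tmul]

theorem comul_gen (a b : Fin n) : comul n (gen a b) = ∑ k, gen a k ⊗ₜ[ℂ] gen k b :=
  lift_gen _ _ a b

theorem comul_word (i j : Fin m → Fin n) :
    comul n (word gen i j) = ∑ k : Fin m → Fin n, word gen i k ⊗ₜ[ℂ] word gen k j := by
  rw [map_word]
  simp only [word, comul_gen, prod_ofFn_sum, prod_ofFn_tmul]

theorem isMagicUnitary_comul : IsMagicUnitary
    (fun i j : Fin n => ∑ k, (gen i k : PolyAlg n) ⊗ₜ[ℂ] (gen k j : PolyAlg n)) :=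
  { magicRelations_comul with
    star_eq := fun i j => by simp only [star_sum, TensorProduct.star_tmul, star_gen] }

theorem comul_star (a : PolyAlg n) : comul n (star a) = star (comul n a) :=
  map_star_lift _ isMagicUnitary_comul a

/-! ### Convolution of states -/

/-- The tensor product `φ ⊗ h` of two functionals. -/
def tensorFunctional (φ h : PolyAlg n →ₗ[ℂ] ℂ) : PolyAlg n ⊗[ℂ] PolyAlg n →ₗ[ℂ] ℂ :=
  LinearMap.mul' ℂ ℂ ∘ₗ TensorProduct.map φ h

@[simp]
theorem tensorFunctional_tmul (φ h : PolyAlg n →ₗ[ℂ] ℂ) (a b : PolyAlg n) :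
    tensorFunctional φ h (a ⊗ₜ b) = φ a * h b := rfl

/-- The matrix `φ (a k* a l)` of a state is positive semidefinite. -/
theorem IsState.posSemidef {φ : PolyAlg n →ₗ[ℂ] ℂ} (hφ : IsState φ) {ι : Type*} [Fintype ι]
    (a : ι → PolyAlg n) : (Matrix.of fun k l => φ (star (a k) * a l)).PosSemidef := by
  rw [Matrix.posSemidef_iff_dotProduct_mulVec]
  refine ⟨Matrix.IsHermitian.ext fun k l => ?_, fun x => ?_⟩
  · rw [Matrix.of_apply, Matrix.of_apply, ← hφ.map_star, star_mul, star_star]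
  · have h := hφ.nonneg (∑ l, x l • a l)
    have e : φ (star (∑ l, x l • a l) * ∑ l, x l • a l) =
        ∑ k, star (x k) * ∑ l, φ (star (a k) * a l) * x l := by
      rw [star_sum, Finset.sum_mul_sum]
      simp only [star_smul, map_sum, Finset.mul_sum, smul_mul_smul_comm, map_smul, smul_eq_mul]
      exact Finset.sum_congr rfl fun k _ => Finset.sum_congr rfl fun l _ => by ring
    rw [e] at h
    simpa [dotProduct, Matrix.mulVec] using h

/-- The tensor product of two states is positive, by the Schur product theorem. -/
theorem IsState.tensor_nonneg {φ h : PolyAlg n →ₗ[ℂ] ℂ} (hφ : IsState φ) (hh : IsState h)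
    (t : PolyAlg n ⊗[ℂ] PolyAlg n) : 0 ≤ tensorFunctional φ h (star t * t) := by
  obtain ⟨S, rfl⟩ := TensorProduct.exists_finset t
  have hpos := (hφ.posSemidef fun p : S => p.1.1).hadamard (hh.posSemidef fun p : S => p.1.2)
  rw [Matrix.posSemidef_iff_dotProduct_mulVec] at hpos
  have h1 := hpos.2 1
  have e : tensorFunctional φ h (star (∑ p ∈ S, p.1 ⊗ₜ[ℂ] p.2) * ∑ p ∈ S, p.1 ⊗ₜ[ℂ] p.2) =
      ∑ p : S, ∑ q : S, φ (star p.1.1 * q.1.1) * h (star p.1.2 * q.1.2) := by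
    rw [← Finset.sum_coe_sort S]
    simp only [star_sum, Finset.sum_mul_sum, TensorProduct.star_tmul,
      Algebra.TensorProduct.tmul_mul_tmul, map_sum, tensorFunctional_tmul]
  rw [e]
  simpa [dotProduct, Matrix.mulVec, Matrix.hadamard] using h1

/-- The convolution operator `(φ ⊗ id) ∘ Δ`. Composed with a functional `h` it gives the
convolution product `φ * h = (φ ⊗ h) ∘ Δ`. -/
def conv (φ : PolyAlg n →ₗ[ℂ] ℂ) : PolyAlg n →ₗ[ℂ] PolyAlg n :=
  (TensorProduct.lid ℂ (PolyAlg n)).toLinearMap ∘ₗ φ.rTensor (PolyAlg n) ∘ₗ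
    (comul n).toLinearMap

theorem conv_word (φ : PolyAlg n →ₗ[ℂ] ℂ) (i j : Fin m → Fin n) :
    conv φ (word gen i j) = ∑ k : Fin m → Fin n, φ (word gen i k) • word gen k j := by
  change (TensorProduct.lid ℂ (PolyAlg n)) (φ.rTensor (PolyAlg n) (comul n (word gen i j))) = _
  simp [comul_word]

theorem apply_conv (φ h : PolyAlg n →ₗ[ℂ] ℂ) (a : PolyAlg n) :
    h (conv φ a) = tensorFunctional φ h (comul n a) := by
  change (h ∘ₗ (TensorProduct.lid ℂ (PolyAlg n)).toLinearMap ∘ₗ φ.rTensor (PolyAlg n))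
    (comul n a) = _
  congr 1
  ext
  simp

theorem IsState.comp_conv {φ h : PolyAlg n →ₗ[ℂ] ℂ} (hφ : IsState φ) (hh : IsState h) :
    IsState (h ∘ₗ conv φ) where
  map_one := by
    rw [LinearMap.comp_apply, apply_conv, _root_.map_one, Algebra.TensorProduct.one_def,
      tensorFunctional_tmul, hφ.map_one, hh.map_one, one_mul]
  nonneg a := by
    rw [LinearMap.comp_apply, apply_conv, map_mul, comul_star]
    exact hφ.tensor_nonneg hh _

/-! ### The matrices of a state -/

/-- The operator on `(ℂ ^ n) ^ ⊗ m` whose entries are the values of a functional on the entries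
of the `m`-th tensor power of the fundamental matrix. -/
def levelOp (φ : PolyAlg n →ₗ[ℂ] ℂ) (m : ℕ) :
    EuclideanSpace ℂ (Fin m → Fin n) →L[ℂ] EuclideanSpace ℂ (Fin m → Fin n) :=
  Matrix.toEuclideanCLM (𝕜 := ℂ) (Matrix.of fun i j => φ (word gen i j))

theorem levelOp_apply (φ : PolyAlg n →ₗ[ℂ] ℂ) (ξ : EuclideanSpace ℂ (Fin m → Fin n))
    (i : Fin m → Fin n) : levelOp φ m ξ i = φ (∑ j, ξ j • word gen i j) := by
  simp [levelOp, Matrix.ofLp_toEuclideanCLM, Matrix.mulVec, dotProduct, mul_comm]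

theorem levelOp_single (φ : PolyAlg n →ₗ[ℂ] ℂ) (i j : Fin m → Fin n) :
    levelOp φ m (EuclideanSpace.single j 1) i = φ (word gen i j) := by
  simp [levelOp_apply, ite_smul]

theorem apply_word_eq_of_levelOp_eq {m : ℕ} {φ h : PolyAlg n →ₗ[ℂ] ℂ} (e : levelOp φ m = levelOp h m)
    (i j : Fin m → Fin n) : φ (word gen i j) = h (word gen i j) := by
  rw [← levelOp_single, e, levelOp_single]

theorem levelOp_comp_conv (φ h : PolyAlg n →ₗ[ℂ] ℂ) (m : ℕ) :
    levelOp (h ∘ₗ conv φ) m = levelOp φ m * levelOp h m := by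
  rw [levelOp, levelOp, levelOp, ← map_mul]
  congr 1
  ext i j
  simp [conv_word, Matrix.mul_apply]

theorem IsState.norm_levelOp_apply_le {φ : PolyAlg n →ₗ[ℂ] ℂ} (hφ : IsState φ)
    (ξ : EuclideanSpace ℂ (Fin m → Fin n)) : ‖levelOp φ m ξ‖ ≤ ‖ξ‖ := by
  rw [← sq_le_sq₀ (norm_nonneg _) (norm_nonneg _), EuclideanSpace.norm_sq_eq,
    EuclideanSpace.norm_sq_eq]
  have e : ∑ i, star (∑ j, ξ j • (word gen i j : PolyAlg n)) * ∑ j, ξ j • word gen i j =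
      (∑ j, star (ξ j) * ξ j) • (1 : PolyAlg n) := by
    simp only [star_sum, Finset.sum_mul_sum, star_smul, smul_mul_smul_comm]
    rw [Finset.sum_comm, Finset.sum_smul]
    refine Finset.sum_congr rfl fun j _ => ?_
    rw [Finset.sum_comm]
    simp_rw [← Finset.smul_sum, isMagicUnitary_gen.sum_star_word_mul_word]
    simp
  calc ∑ i, ‖levelOp φ m ξ i‖ ^ 2
      ≤ ∑ i, (φ (star (∑ j, ξ j • word gen i j) * ∑ j, ξ j • word gen i j)).re :=
        Finset.sum_le_sum fun i _ => by
          rw [levelOp_apply]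
          exact hφ.norm_sq_le _
    _ = (∑ j, star (ξ j) * ξ j).re := by
        rw [← Complex.re_sum, ← map_sum, e, map_smul, hφ.map_one, smul_eq_mul, mul_one]
    _ = ∑ j, ‖ξ j‖ ^ 2 := by
        rw [Complex.re_sum]
        refine Finset.sum_congr rfl fun j _ => ?_
        rw [Complex.star_def, ← Complex.normSq_eq_conj_mul_self, Complex.ofReal_re, Complex.sq_norm]

theorem IsState.norm_levelOp_le {φ : PolyAlg n →ₗ[ℂ] ℂ} (hφ : IsState φ) (m : ℕ) :
    ‖levelOp φ m‖ ≤ 1 :=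
  ContinuousLinearMap.opNorm_le_bound _ zero_le_one fun ξ => by
    simpa using hφ.norm_levelOp_apply_le ξ

end PolyAlg

/-! ### Contractions and their fixed vectors -/

section Contraction

variable {E : Type*} [NormedAddCommGroup E] [InnerProductSpace ℂ E]

/-- Strict convexity of the ball of a Hilbert space: a vector is not a proper average of vectors
which are not longer than it. -/
theorem eq_of_average_eq {ι : Type*} {s : Finset ι} {x : E} {y : ι → E}
    (hy : ∀ k ∈ s, ‖y k‖ ≤ ‖x‖) (h : (s.card : ℂ)⁻¹ • ∑ k ∈ s, y k = x) :
    ∀ k ∈ s, y k = x := by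
  intro k hk
  have hs : (s.card : ℂ) ≠ 0 := by
    simpa using (Finset.card_pos.2 ⟨k, hk⟩).ne'
  have hsum : ∑ k ∈ s, y k = (s.card : ℂ) • x := by
    rw [← h, smul_inv_smul₀ hs]
  have h1 : ∑ k ∈ s, ‖y k - x‖ ^ 2 ≤ 0 :=
    calc ∑ k ∈ s, ‖y k - x‖ ^ 2
        ≤ ∑ k ∈ s, (2 * ‖x‖ ^ 2 - 2 * (⟪y k, x⟫_ℂ).re) := Finset.sum_le_sum fun k hk => by
          have h2 := norm_sub_sq (𝕜 := ℂ) (y k) x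
          have h3 := pow_le_pow_left₀ (norm_nonneg _) (hy k hk) 2
          rw [RCLike.re_eq_complex_re] at h2
          linarith
      _ = 2 * s.card * ‖x‖ ^ 2 - 2 * (⟪∑ k ∈ s, y k, x⟫_ℂ).re := by
          rw [Finset.sum_sub_distrib, ← Finset.mul_sum, sum_inner, Complex.re_sum]
          rw [← Finset.mul_sum, Finset.sum_const, nsmul_eq_mul]
          ring
      _ = 0 := by
          rw [hsum, inner_smul_left, inner_self_eq_norm_sq_to_K]
          simp [← Complex.ofReal_pow, ← Complex.ofReal_natCast]
          ring
  have h2 := (Finset.sum_eq_zero_iff_of_nonneg fun k _ => sq_nonneg ‖y k - x‖).1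
    (le_antisymm h1 (Finset.sum_nonneg fun k _ => sq_nonneg _)) k hk
  exact sub_eq_zero.1 (norm_eq_zero.1 (pow_eq_zero_iff two_ne_zero |>.1 h2))

variable [CompleteSpace E]

/-- The fixed vectors of a contraction are fixed by its adjoint. -/
theorem adjoint_apply_eq_self {T : E →L[ℂ] E} (hT : ‖T‖ ≤ 1) {x : E} (hx : T x = x) :
    ContinuousLinearMap.adjoint T x = x := by
  set y := ContinuousLinearMap.adjoint T x with hy
  have h1 : ‖y‖ ≤ ‖x‖ := by
    have h2 := (ContinuousLinearMap.adjoint T).le_opNorm x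
    rw [LinearIsometryEquiv.norm_map] at h2
    exact h2.trans (mul_le_of_le_one_left (norm_nonneg _) hT)
  have h3 : ⟪y, x⟫_ℂ = ⟪x, x⟫_ℂ := by
    rw [hy, ContinuousLinearMap.adjoint_inner_left, hx]
  have h4 := norm_sub_sq (𝕜 := ℂ) y x
  rw [h3, inner_self_eq_norm_sq] at h4
  have h5 := pow_le_pow_left₀ (norm_nonneg _) h1 2
  have h6 : ‖y - x‖ ^ 2 = 0 := le_antisymm (by linarith) (sq_nonneg _)
  exact sub_eq_zero.1 (norm_eq_zero.1 (pow_eq_zero_iff two_ne_zero |>.1 h6))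

end Contraction

/-! ### Existence and uniqueness of the Haar state -/

namespace PolyAlg

variable {n : ℕ}

theorem isMagicUnitary_one :
    IsMagicUnitary (fun i j : Fin n => if i = j then (1 : ℂ) else 0) where
  idem i j := by simp
  row_orth i k l h := by
    by_cases hk : i = k
    · simp [hk, h]
    · simp [hk]
  col_orth i k l h := by
    by_cases hk : k = i
    · subst hk
      simp [h.symm]
    · simp [hk]
  row_sum i := by simp
  col_sum i := by simp
  star_eq i j := by split_ifs <;> simp

/-- The counit. -/
def counit (n : ℕ) : PolyAlg n →ₐ[ℂ] ℂ := lift _ isMagicUnitary_one.toMagicRelations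

theorem isState_counit : IsState (counit n).toLinearMap where
  map_one := map_one (counit n)
  nonneg a := by
    rw [AlgHom.toLinearMap_apply, map_mul, counit, map_star_lift _ isMagicUnitary_one]
    exact star_mul_self_nonneg _

theorem IsState.average {ι : Type*} {s : Finset ι} (hs : s.Nonempty)
    {φ : ι → PolyAlg n →ₗ[ℂ] ℂ} (hφ : ∀ k ∈ s, IsState (φ k)) :
    IsState ((s.card : ℂ)⁻¹ • ∑ k ∈ s, φ k) where
  map_one := by
    rw [LinearMap.smul_apply, LinearMap.sum_apply,
      Finset.sum_congr rfl fun k hk => (hφ k hk).map_one]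
    simp [hs.card_ne_zero]
  nonneg a := by
    rw [LinearMap.smul_apply, LinearMap.sum_apply]
    have h : (0 : ℂ) ≤ (s.card : ℂ)⁻¹ := by
      rw [← Complex.ofReal_natCast, ← Complex.ofReal_inv, Complex.zero_le_real]
      positivity
    exact mul_nonneg h (Finset.sum_nonneg fun k hk => (hφ k hk).nonneg a)

/-- The set of states, as functions. -/
def stateSet (n : ℕ) : Set (PolyAlg n → ℂ) := {f | ∃ φ : PolyAlg n →ₗ[ℂ] ℂ, IsState φ ∧ ⇑φ = f}

theorem isCompact_stateSet : IsCompact (stateSet n) := by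
  have hK : IsCompact (Set.univ.pi fun a : PolyAlg n => Metric.closedBall (0 : ℂ) ‖a‖) :=
    isCompact_univ_pi fun a => isCompact_closedBall 0 ‖a‖
  have h : stateSet n = {f | (∀ a b, f (a + b) = f a + f b) ∧ (∀ (c : ℂ) a, f (c • a) = c * f a) ∧
      f 1 = 1 ∧ ∀ a, 0 ≤ f (star a * a)} := by
    ext f
    constructor
    · rintro ⟨φ, hφ, rfl⟩
      exact ⟨map_add φ, map_smul φ, hφ.map_one, hφ.nonneg⟩
    · rintro ⟨h1, h2, h3, h4⟩
      exact ⟨⟨⟨f, h1⟩, h2⟩, ⟨h3, h4⟩, rfl⟩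
  refine hK.of_isClosed_subset ?_ ?_
  · rw [h]
    simp only [Set.ofPred_and, Set.ofPred_forall]
    refine .inter ?_ (.inter ?_ (.inter ?_ ?_))
    · exact isClosed_iInter fun a => isClosed_iInter fun b =>
        isClosed_eq (continuous_apply _) ((continuous_apply a).add (continuous_apply b))
    · exact isClosed_iInter fun c => isClosed_iInter fun a =>
        isClosed_eq (continuous_apply _) (continuous_const.mul (continuous_apply _))
    · exact isClosed_eq (continuous_apply _) continuous_const
    · exact isClosed_iInter fun a => isClosed_le continuous_const (continuous_apply _)
  · rintro _ ⟨φ, hφ, rfl⟩ a -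
    simpa using hφ.norm_apply_le a

/-- The Cesàro means of the convolution powers of a state accumulate at a state which is invariant
under convolution with it. -/
theorem IsState.exists_conv_eq {φ : PolyAlg n →ₗ[ℂ] ℂ} (hφ : IsState φ) :
    ∃ h : PolyAlg n →ₗ[ℂ] ℂ, IsState h ∧ h ∘ₗ conv φ = h := by
  let s : ℕ → PolyAlg n →ₗ[ℂ] ℂ := fun k => (counit n).toLinearMap ∘ₗ (conv φ ^ k)
  have hs_succ : ∀ k, s (k + 1) = s k ∘ₗ conv φ := fun k => by
    simp only [s, pow_succ]
    rfl
  have hs : ∀ k, IsState (s k) := by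
    intro k
    induction k with
    | zero => exact isState_counit
    | succ k ih => rw [hs_succ]; exact hφ.comp_conv ih
  let c : ℕ → PolyAlg n →ₗ[ℂ] ℂ := fun N =>
    ((Finset.range (N + 1)).card : ℂ)⁻¹ • ∑ k ∈ Finset.range (N + 1), s k
  have hc : ∀ N, IsState (c N) := fun N =>
    IsState.average Finset.nonempty_range_add_one fun k _ => hs k
  obtain ⟨f, ⟨h, hh, rfl⟩, hf⟩ := isCompact_stateSet.ultrafilter_le_nhds
    ((Filter.hyperfilter ℕ).map fun N => (c N : PolyAlg n → ℂ))
    (Filter.le_principal_iff.2 (Filter.mem_map.2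
      (Filter.univ_mem' fun N => ⟨c N, hc N, rfl⟩)))
  have hlim : ∀ a, Filter.Tendsto (fun N => c N a) (Filter.hyperfilter ℕ) (nhds (h a)) :=
    fun a => ((continuous_apply a).tendsto _).comp hf
  refine ⟨h, hh, LinearMap.ext fun a => ?_⟩
  have htel : ∀ N : ℕ, c N (conv φ a) - c N a = ((N + 1 : ℕ) : ℂ)⁻¹ * (s (N + 1) a - s 0 a) := by
    intro N
    simp only [c, LinearMap.smul_apply, LinearMap.sum_apply, Finset.card_range, smul_eq_mul]
    rw [← mul_sub, ← Finset.sum_sub_distrib, ← Finset.sum_range_sub (fun k => s k a)]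
    simp only [hs_succ, LinearMap.comp_apply]
  have hzero : Filter.Tendsto (fun N => c N (conv φ a) - c N a) Filter.atTop (nhds 0) := by
    have h1 : Filter.Tendsto (fun N : ℕ => ((N : ℝ) + 1)⁻¹ * (2 * ‖a‖)) Filter.atTop (nhds 0) := by
      simpa using (tendsto_inv_atTop_zero.comp (Filter.tendsto_atTop_add_const_right _ (1 : ℝ)
        tendsto_natCast_atTop_atTop)).mul_const (2 * ‖a‖)
    refine squeeze_zero_norm (fun N => ?_) h1
    rw [htel, norm_mul, norm_inv, Complex.norm_natCast, Nat.cast_add, Nat.cast_one]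
    gcongr
    calc ‖s (N + 1) a - s 0 a‖ ≤ ‖s (N + 1) a‖ + ‖s 0 a‖ := norm_sub_le _ _
      _ ≤ 2 * ‖a‖ := by linarith [(hs (N + 1)).norm_apply_le a, (hs 0).norm_apply_le a]
  exact sub_eq_zero.1 (tendsto_nhds_unique ((hlim (conv φ a)).sub (hlim a))
    (hzero.mono_left Nat.hyperfilter_le_atTop))

theorem levelOp_average {ι : Type*} (s : Finset ι) (φ : ι → PolyAlg n →ₗ[ℂ] ℂ) (m : ℕ)
    (ξ : EuclideanSpace ℂ (Fin m → Fin n)) :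
    levelOp ((s.card : ℂ)⁻¹ • ∑ k ∈ s, φ k) m ξ =
      (s.card : ℂ)⁻¹ • ∑ k ∈ s, levelOp (φ k) m ξ := by
  ext i
  rw [levelOp_apply, PiLp.smul_apply, WithLp.ofLp_sum, Finset.sum_apply]
  simp only [levelOp_apply, LinearMap.smul_apply, LinearMap.sum_apply]

theorem comp_conv_eq_iff {φ h g : PolyAlg n →ₗ[ℂ] ℂ} :
    h ∘ₗ conv φ = g ↔ ∀ m, levelOp φ m * levelOp h m = levelOp g m := by
  constructor
  · rintro rfl m
    exact (levelOp_comp_conv φ h m).symm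
  · intro e
    refine linearMap_ext fun m i j => apply_word_eq_of_levelOp_eq ?_ i j
    rw [levelOp_comp_conv, e]

/-- A state which is invariant under convolution with an average of states is invariant under
convolution with each of them. -/
theorem IsState.conv_eq_of_average {ι : Type*} {s : Finset ι} {φ : ι → PolyAlg n →ₗ[ℂ] ℂ}
    (hφ : ∀ k ∈ s, IsState (φ k)) {h : PolyAlg n →ₗ[ℂ] ℂ}
    (hh : h ∘ₗ conv ((s.card : ℂ)⁻¹ • ∑ k ∈ s, φ k) = h) : ∀ k ∈ s, h ∘ₗ conv (φ k) = h := by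
  intro k hk
  rw [comp_conv_eq_iff] at hh ⊢
  intro m
  ext1 ξ
  refine eq_of_average_eq (s := s) (x := levelOp h m ξ)
    (y := fun k => levelOp (φ k) m (levelOp h m ξ))
    (fun k hk => (hφ k hk).norm_levelOp_apply_le _) ?_ k hk
  rw [← levelOp_average]
  exact DFunLike.congr_fun (hh m) ξ

/-- Existence of an idempotent state which absorbs all states under convolution. -/
theorem exists_state_conv_eq (n : ℕ) : ∃ h : PolyAlg n →ₗ[ℂ] ℂ, IsState h ∧
    ∀ φ : PolyAlg n →ₗ[ℂ] ℂ, IsState φ → h ∘ₗ conv φ = h := by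
  let t : {φ : PolyAlg n →ₗ[ℂ] ℂ // IsState φ} → Set (PolyAlg n → ℂ) :=
    fun φ => {f | ∀ a, f (conv φ.1 a) = f a}
  obtain ⟨f, ⟨h, hh, rfl⟩, hf⟩ := isCompact_stateSet.inter_iInter_nonempty t
    (fun φ => by
      simp only [t, Set.ofPred_forall]
      exact isClosed_iInter fun a => isClosed_eq (continuous_apply _) (continuous_apply _))
    (fun s => by
      rcases s.eq_empty_or_nonempty with rfl | hs
      · exact ⟨_, ⟨_, isState_counit, rfl⟩, by simp⟩
      · obtain ⟨h, hh, e⟩ := (IsState.average hs fun φ _ => φ.2).exists_conv_eq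
        refine ⟨h, ⟨h, hh, rfl⟩, Set.mem_iInter₂.2 fun φ hφ a => ?_⟩
        exact DFunLike.congr_fun (IsState.conv_eq_of_average (fun φ _ => φ.2) e φ hφ) a)
  exact ⟨h, hh, fun φ hφ => LinearMap.ext fun a => Set.mem_iInter.1 hf ⟨φ, hφ⟩ a⟩

/-- Absorption from one side implies absorption from the other side. -/
theorem IsState.comp_conv_eq {h : PolyAlg n →ₗ[ℂ] ℂ} (hh : IsState h)
    (hinv : ∀ φ : PolyAlg n →ₗ[ℂ] ℂ, IsState φ → h ∘ₗ conv φ = h)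
    {φ : PolyAlg n →ₗ[ℂ] ℂ} (hφ : IsState φ) : φ ∘ₗ conv h = h := by
  rw [comp_conv_eq_iff]
  intro m
  -- the range of `levelOp h m` consists of vectors fixed by all `levelOp φ m`, hence by adjoints
  have h1 : ∀ {φ : PolyAlg n →ₗ[ℂ] ℂ}, IsState φ →
      ContinuousLinearMap.adjoint (levelOp φ m) * levelOp h m = levelOp h m := by
    intro φ hφ
    ext1 ξ
    refine adjoint_apply_eq_self (hφ.norm_levelOp_le m) ?_
    exact DFunLike.congr_fun (comp_conv_eq_iff.1 (hinv φ hφ) m) ξ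
  have h2 : star (levelOp h m) = levelOp h m := by
    have h3 := h1 hh
    rw [← ContinuousLinearMap.star_eq_adjoint] at h3
    rw [← h3, star_mul, star_star]
  have h4 := congrArg star (h1 hφ)
  rwa [← ContinuousLinearMap.star_eq_adjoint, star_mul, star_star, h2] at h4

end PolyAlg

namespace QPerm

variable {n : ℕ}

theorem map_sliceRight (χ ψ : QPerm n →ₚ[ℂ] ℂ) (t : PolyAlg n ⊗[ℂ] PolyAlg n) :
    χ (sliceRight ψ t) = PolyAlg.tensorFunctional (χ.toLinearMap ∘ₗ (ofPoly n).toLinearMap)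
      (ψ.toLinearMap ∘ₗ (ofPoly n).toLinearMap) t := by
  induction t using TensorProduct.induction_on with
  | zero => simp
  | tmul a b => simp [sliceRight, mul_comm]
  | add x y hx hy => rw [map_add, map_add, map_add, hx, hy]

theorem map_sliceLeft (χ ψ : QPerm n →ₚ[ℂ] ℂ) (t : PolyAlg n ⊗[ℂ] PolyAlg n) :
    χ (sliceLeft ψ t) = PolyAlg.tensorFunctional (ψ.toLinearMap ∘ₗ (ofPoly n).toLinearMap)
      (χ.toLinearMap ∘ₗ (ofPoly n).toLinearMap) t := by
  induction t using TensorProduct.induction_on with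
  | zero => simp
  | tmul a b => simp [sliceLeft]
  | add x y hx hy => rw [map_add, map_add, map_add, hx, hy]

theorem exists_isHaarState (n : ℕ) : ∃ ψ : QPerm n →ₚ[ℂ] ℂ, IsHaarState ψ := by
  obtain ⟨h, hh, hinv⟩ := PolyAlg.exists_state_conv_eq n
  obtain ⟨ψ, hψ⟩ := hh.exists_extension
  have he : ψ.toLinearMap ∘ₗ (ofPoly n).toLinearMap = h := LinearMap.ext hψ
  refine ⟨ψ, ?_, fun a => ?_, fun a => ?_⟩
  · rw [← map_one (ofPoly n), hψ, hh.map_one]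
  · refine sub_eq_zero.1 (eq_zero_of_forall_state fun χ h1 => ?_)
    rw [map_sub, map_sliceRight, he, ← PolyAlg.apply_conv, map_smul, h1, smul_eq_mul, mul_one, hψ,
      sub_eq_zero]
    exact DFunLike.congr_fun (hinv _ (isState_comp_ofPoly χ h1)) a
  · refine sub_eq_zero.1 (eq_zero_of_forall_state fun χ h1 => ?_)
    rw [map_sub, map_sliceLeft, he, ← PolyAlg.apply_conv, map_smul, h1, smul_eq_mul, mul_one, hψ,
      sub_eq_zero]
    exact DFunLike.congr_fun (hh.comp_conv_eq hinv (isState_comp_ofPoly χ h1)) a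

/-- Two Haar states agree, since both of them agree with their convolution product. -/
theorem IsHaarState.eq {ψ χ : QPerm n →ₚ[ℂ] ℂ} (hψ : IsHaarState ψ) (hχ : IsHaarState χ) :
    ψ = χ := by
  refine DFunLike.coe_injective (denseRange_ofPoly.equalizer (map_continuous ψ)
    (map_continuous χ) (funext fun a => ?_))
  have h1 := congrArg χ (hψ.invariant_left a)
  have h2 := congrArg ψ (hχ.invariant_right a)
  rw [map_sliceLeft, map_smul, hχ.map_one, smul_eq_mul, mul_one] at h1
  rw [map_sliceRight, map_smul, hψ.map_one, smul_eq_mul, mul_one] at h2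
  exact h1.symm.trans h2

theorem existsUnique_isHaarState (n : ℕ) : ∃! ψ : QPerm n →ₚ[ℂ] ℂ, IsHaarState ψ := by
  obtain ⟨ψ, hψ⟩ := exists_isHaarState n
  exact ⟨ψ, hψ, fun χ hχ => hχ.eq hψ⟩

end QPerm

/-! ### The Haar state is a trace -/

namespace MagicRelations

variable {n : ℕ} {R : Type*} [Ring R] {v : Fin n → Fin n → R}

theorem mul_eq_ite_row (hv : MagicRelations v) (a b c : Fin n) :
    v a b * v a c = if b = c then v a b else 0 := by
  split_ifs with h
  · rw [← h, hv.idem]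
  · exact hv.row_orth a b c h

theorem mul_eq_ite_col (hv : MagicRelations v) (a b c : Fin n) :
    v b a * v c a = if b = c then v b a else 0 := by
  split_ifs with h
  · rw [← h, hv.idem]
  · exact hv.col_orth a b c h

theorem transpose (hv : MagicRelations v) : MagicRelations fun a b => v b a where
  idem i j := hv.idem j i
  row_orth i k l h := hv.col_orth i k l h
  col_orth i k l h := hv.row_orth i k l h
  row_sum := hv.col_sum
  col_sum := hv.row_sum

variable [Algebra ℂ R]

/-- A system of linear equations with coefficients in a magic unitary on the left is solved by
the transposed matrix, and the solution also satisfies the system with coefficients on the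
right. This is what makes the fixed vectors of tensor powers invariant under cyclic rotation. -/
theorem sum_mul_right_of_sum_mul_left (hv : MagicRelations v) {F : Fin n → R} {g : Fin n → ℂ}
    (h : ∀ a, ∑ b, v a b * F b = g a • (1 : R)) (k : Fin n) :
    ∑ b, F b * v k b = g k • (1 : R) := by
  have hF : ∀ b, F b = ∑ a, g a • v a b := fun b => by
    have h1 : ∀ a, v a b * F b = g a • v a b := fun a => by
      have h2 := congrArg (v a b * ·) (h a)
      simpa [Finset.mul_sum, ← mul_assoc, hv.mul_eq_ite_row] using h2
    rw [← Finset.sum_congr rfl fun a _ => h1 a, ← Finset.sum_mul, hv.col_sum, one_mul]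
  simp_rw [hF, Finset.sum_mul, smul_mul_assoc, hv.mul_eq_ite_col]
  simp [← Finset.smul_sum, hv.row_sum]

theorem sum_mul_left_of_sum_mul_right (hv : MagicRelations v) {F : Fin n → R} {g : Fin n → ℂ}
    (h : ∀ a, ∑ b, F b * v a b = g a • (1 : R)) (k : Fin n) :
    ∑ b, v k b * F b = g k • (1 : R) := by
  have hF : ∀ b, F b = ∑ a, g a • v a b := fun b => by
    have h1 : ∀ a, F b * v a b = g a • v a b := fun a => by
      have h2 := congrArg (· * v a b) (h a)
      simpa [Finset.sum_mul, mul_assoc, hv.mul_eq_ite_row] using h2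
    rw [← Finset.sum_congr rfl fun a _ => h1 a, ← Finset.mul_sum, hv.col_sum, mul_one]
  simp_rw [hF, Finset.mul_sum, mul_smul_comm, hv.mul_eq_ite_col]
  rw [Finset.sum_congr rfl fun b _ => Finset.sum_eq_single k (fun a _ ha => by simp [ha.symm])
    (by simp)]
  simp [← Finset.smul_sum, hv.row_sum]

end MagicRelations

namespace QPerm

variable {n m : ℕ}

theorem ofPoly_word (i j : Fin m → Fin n) : ofPoly n (word PolyAlg.gen i j) = word u i j :=
  map_word (ofPoly n) _ i j

variable {ψ : QPerm n →ₚ[ℂ] ℂ}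

theorem IsHaarState.sum_right (hψ : IsHaarState ψ) (i j : Fin m → Fin n) :
    ∑ k, ψ (word u k j) • word u i k = ψ (word u i j) • (1 : QPerm n) := by
  have h := hψ.invariant_right (word PolyAlg.gen i j)
  rw [PolyAlg.comul_word, map_sum, ofPoly_word] at h
  rw [← h]
  simp [sliceRight, ofPoly_word]

theorem IsHaarState.sum_left (hψ : IsHaarState ψ) (i j : Fin m → Fin n) :
    ∑ k, ψ (word u i k) • word u k j = ψ (word u i j) • (1 : QPerm n) := by
  have h := hψ.invariant_left (word PolyAlg.gen i j)
  rw [PolyAlg.comul_word, map_sum, ofPoly_word] at h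
  rw [← h]
  simp [sliceLeft, ofPoly_word]

/-- With `T` the matrix of the Haar state and `R` the cyclic rotation of tensor factors, both
sides are entries of `R T` and `T R`. They agree with the corresponding entry of `T R T`. -/
theorem IsHaarState.apply_u_mul_word (hψ : IsHaarState ψ) (a c : Fin n) (i k : Fin m → Fin n) :
    ψ (u a c * word u i k) = ψ (word u i k * u a c) := by
  have hu := (isMagicUnitary_u (n := n)).toMagicRelations
  have h1 : ∑ b, (∑ j, ψ (u b c * word u j k) • word u i j) * u a b =
      ψ (u a c * word u i k) • (1 : QPerm n) := by
    refine hu.sum_mul_right_of_sum_mul_left (g := fun a => ψ (u a c * word u i k)) (fun a => ?_) a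
    have h := hψ.sum_right (Fin.cons a i : Fin (m + 1) → Fin n) (Fin.cons c k)
    rw [sum_fin_succ_pi] at h
    simpa only [word_cons, Finset.mul_sum, mul_smul_comm] using h
  have h2 : ∑ b, u b c * (∑ j, ψ (word u i j * u a b) • word u j k) =
      ψ (word u i k * u a c) • (1 : QPerm n) := by
    refine hu.transpose.sum_mul_left_of_sum_mul_right (g := fun c => ψ (word u i k * u a c))
      (fun c => ?_) c
    have h := hψ.sum_left (Fin.snoc i a : Fin (m + 1) → Fin n) (Fin.snoc k c)
    rw [sum_fin_succ_pi_snoc] at h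
    simpa only [word_snoc, Finset.sum_mul, smul_mul_assoc] using h
  have h3 := congrArg ψ h1
  have h4 := congrArg ψ h2
  simp only [Finset.sum_mul, Finset.mul_sum, smul_mul_assoc, mul_smul_comm, map_sum, map_smul,
    hψ.map_one, smul_eq_mul, mul_one] at h3 h4
  rw [← h3, ← h4]
  exact Finset.sum_congr rfl fun b _ => Finset.sum_congr rfl fun j _ => mul_comm _ _

theorem IsHaarState.apply_mul_comm (hψ : IsHaarState ψ) (x y : QPerm n) :
    ψ (x * y) = ψ (y * x) := by
  have hc : Continuous ψ := map_continuous ψ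
  refine induction₂ (P := fun x y => ψ (x * y) = ψ (y * x)) x y
    (isClosed_eq (hc.comp (by fun_prop)) (hc.comp (by fun_prop))) fun a => ?_
  induction a using PolyAlg.induction_on with
  | halg c =>
    intro b
    rw [AlgHom.commutes, Algebra.commutes]
  | hgen a c =>
    intro b
    rw [← map_mul, ← map_mul]
    refine DFunLike.congr_fun (f := (ψ.toLinearMap ∘ₗ (ofPoly n).toLinearMap) ∘ₗ
      LinearMap.mulLeft ℂ (PolyAlg.gen a c)) (g := (ψ.toLinearMap ∘ₗ (ofPoly n).toLinearMap) ∘ₗ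
      LinearMap.mulRight ℂ (PolyAlg.gen a c)) (PolyAlg.linearMap_ext fun m i j => ?_) b
    simpa [ofPoly_word, u] using hψ.apply_u_mul_word a c i j
  | hmul a a' ha ha' =>
    intro b
    have h1 := ha (a' * b)
    have h2 := ha' (b * a)
    simp only [map_mul, mul_assoc] at h1 h2 ⊢
    rw [h1, h2]
  | hadd a a' ha ha' =>
    intro b
    rw [map_add, add_mul, mul_add, map_add, map_add, ha, ha']

end QPerm

/-! ### The cyclic vector of a trace is separating -/

section GNS

variable {n : ℕ} {ψ : QPerm n →ₚ[ℂ] ℂ}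

theorem gnsStarAlgHom_coe (a b : QPerm n) :
    ψ.gnsStarAlgHom a ((ψ.toPreGNS b : ψ.PreGNS) : UniformSpace.Completion ψ.PreGNS) =
      ((ψ.toPreGNS (a * b) : ψ.PreGNS) : UniformSpace.Completion ψ.PreGNS) :=
  ψ.gnsNonUnitalStarAlgHom_apply_coe

theorem gnsState_toGnsVN (a : QPerm n) : gnsState ψ (toGnsVN ψ a) = ψ a := by
  change ⟪gnsVector ψ, ψ.gnsStarAlgHom a (gnsVector ψ)⟫_ℂ = ψ a
  rw [gnsVector, gnsStarAlgHom_coe, UniformSpace.Completion.inner_coe, ψ.preGNS_inner_def]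
  simp

/-- Right multiplication on the GNS space, which is bounded for a trace. -/
def rightMul (htr : ∀ x y, ψ (x * y) = ψ (y * x)) (a : QPerm n) : ψ.PreGNS →L[ℂ] ψ.PreGNS :=
  (ψ.toPreGNS.toLinearMap ∘ₗ LinearMap.mulRight ℂ a ∘ₗ ψ.ofPreGNS.toLinearMap).mkContinuous ‖a‖
    fun x => by
      rw [← sq_le_sq₀ (norm_nonneg _) (by positivity), mul_pow,
        ← RCLike.ofReal_le_ofReal (K := ℂ), RCLike.ofReal_pow, RCLike.ofReal_eq_complex_ofReal,
        PositiveLinearMap.preGNS_norm_sq]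
      set y := ψ.ofPreGNS x with hy
      change ψ (star (y * a) * (y * a)) ≤ _
      have h1 : ψ (star (y * a) * (y * a)) = ψ (y * (a * star a) * star y) := by
        rw [htr, star_mul]
        simp only [mul_assoc]
      have h2 : y * (a * star a) * star y ≤ ‖a‖ ^ 2 • (y * star y) := by
        rw [sq, ← CStarRing.norm_self_mul_star (x := a)]
        exact CStarAlgebra.star_right_conjugate_le_norm_smul
      calc ψ (star (y * a) * (y * a)) ≤ ψ (‖a‖ ^ 2 • (y * star y)) := by
            rw [h1]
            exact OrderHomClass.mono ψ h2
        _ = _ := by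
            rw [← Complex.coe_smul, map_smul, htr y, smul_eq_mul, hy]
            simp [← PositiveLinearMap.preGNS_norm_sq]

theorem rightMul_completion_coe (htr : ∀ x y, ψ (x * y) = ψ (y * x)) (a b : QPerm n) :
    (rightMul htr a).completion
      ((ψ.toPreGNS b : ψ.PreGNS) : UniformSpace.Completion ψ.PreGNS) =
      ((ψ.toPreGNS (b * a) : ψ.PreGNS) : UniformSpace.Completion ψ.PreGNS) :=
  ContinuousLinearMap.completion_apply_coe _ _

theorem rightMul_mem_centralizer (htr : ∀ x y, ψ (x * y) = ψ (y * x)) (a : QPerm n) :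
    (rightMul htr a).completion ∈
      StarSubalgebra.centralizer ℂ (ψ.gnsStarAlgHom.range : Set (ψ.GNS →L[ℂ] ψ.GNS)) := by
  have h : ∀ b, ψ.gnsStarAlgHom b * (rightMul htr a).completion =
      (rightMul htr a).completion * ψ.gnsStarAlgHom b := fun b => by
    ext x
    induction x using UniformSpace.Completion.induction_on with
    | hp => exact isClosed_eq (ContinuousLinearMap.continuous _) (ContinuousLinearMap.continuous _)
    | ih x =>
      obtain ⟨c, rfl⟩ := ψ.toPreGNS.surjective x
      change ψ.gnsStarAlgHom b ((rightMul htr a).completion _) =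
        (rightMul htr a).completion (ψ.gnsStarAlgHom b _)
      rw [rightMul_completion_coe, gnsStarAlgHom_coe, gnsStarAlgHom_coe, rightMul_completion_coe,
        mul_assoc]
  rw [StarSubalgebra.mem_centralizer_iff]
  rintro _ ⟨b, rfl⟩
  refine ⟨h b, ?_⟩
  have h2 := h (star b)
  rw [map_star] at h2
  exact h2

/-- The cyclic vector of a trace is separating for the generated von Neumann algebra, since it is
cyclic for the right multiplications, which commute with that algebra. -/
theorem eq_zero_of_apply_gnsVector (htr : ∀ x y, ψ (x * y) = ψ (y * x))
    (T : (gnsVN ψ).toStarSubalgebra)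
    (hT : (T : ψ.GNS →L[ℂ] ψ.GNS) (gnsVector ψ) = 0) : T = 0 := by
  refine Subtype.ext (ContinuousLinearMap.ext fun x => ?_)
  change (T : ψ.GNS →L[ℂ] ψ.GNS) x = 0
  induction x using UniformSpace.Completion.induction_on with
  | hp => exact isClosed_eq (ContinuousLinearMap.continuous _) continuous_const
  | ih x =>
    obtain ⟨a, rfl⟩ := ψ.toPreGNS.surjective x
    have hT2 : (T : ψ.GNS →L[ℂ] ψ.GNS) ∈ StarSubalgebra.centralizer ℂ
        (StarSubalgebra.centralizer ℂ (ψ.gnsStarAlgHom.range : Set (ψ.GNS →L[ℂ] ψ.GNS)) :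
          Set (ψ.GNS →L[ℂ] ψ.GNS)) := T.2
    have h := (StarSubalgebra.mem_centralizer_iff ℂ).1 hT2 _ (rightMul_mem_centralizer htr a)
    have h1 := DFunLike.congr_fun h.1 (gnsVector ψ)
    change (rightMul htr a).completion ((T : ψ.GNS →L[ℂ] ψ.GNS) (gnsVector ψ)) =
      (T : ψ.GNS →L[ℂ] ψ.GNS) ((rightMul htr a).completion (gnsVector ψ)) at h1
    rw [hT, map_zero, gnsVector, rightMul_completion_coe, one_mul] at h1
    exact h1.symm

theorem gnsState_star_mul_self (T : (gnsVN ψ).toStarSubalgebra) :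
    gnsState ψ (star T * T) = ((‖(T : ψ.GNS →L[ℂ] ψ.GNS) (gnsVector ψ)‖ ^ 2 : ℝ) : ℂ) := by
  change ⟪gnsVector ψ, (star (T : ψ.GNS →L[ℂ] ψ.GNS))
    ((T : ψ.GNS →L[ℂ] ψ.GNS) (gnsVector ψ))⟫_ℂ = _
  rw [ContinuousLinearMap.star_eq_adjoint, ContinuousLinearMap.adjoint_inner_right,
    inner_self_eq_norm_sq_to_K]
  simp

theorem gnsState_one (h1 : ψ 1 = 1) : gnsState ψ 1 = 1 := by
  have h := gnsState_toGnsVN (ψ := ψ) 1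
  rwa [h1, show toGnsVN ψ 1 = 1 from Subtype.ext (map_one ψ.gnsStarAlgHom)] at h

theorem isNormalFunctional_gnsState : IsNormalFunctional (gnsVN ψ) (gnsState ψ) := by
  let ξ : ℕ → ψ.GNS := Pi.single 0 (gnsVector ψ)
  have hξ : ∀ k, k ≠ 0 → ξ k = 0 := fun k hk => Pi.single_eq_of_ne hk _
  have hs : Summable fun k => ‖ξ k‖ ^ 2 :=
    (hasSum_single 0 fun k hk => by simp [hξ k hk]).summable
  refine ⟨ξ, ξ, hs, hs, fun T => ?_⟩
  have h := hasSum_single (f := fun k => ⟪ξ k, (T : ψ.GNS →L[ℂ] ψ.GNS) (ξ k)⟫_ℂ) 0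
    fun k hk => by simp [hξ k hk]
  change HasSum _ ⟪gnsVector ψ, (T : ψ.GNS →L[ℂ] ψ.GNS) (gnsVector ψ)⟫_ℂ
  simpa [ξ] using h

theorem isWStarProbabilitySpace_gns (h1 : ψ 1 = 1) (htr : ∀ x y, ψ (x * y) = ψ (y * x)) :
    IsWStarProbabilitySpace (gnsVN ψ) (gnsState ψ) where
  map_one := gnsState_one h1
  nonneg T := by
    rw [gnsState_star_mul_self, Complex.zero_le_real]
    positivity
  faithful T hT := by
    rw [gnsState_star_mul_self, Complex.ofReal_eq_zero] at hT
    exact eq_zero_of_apply_gnsVector htr T (norm_eq_zero.1 ((pow_eq_zero_iff two_ne_zero).1 hT))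
  normal := isNormalFunctional_gnsState

end GNS

/-! ### Quantum exchangeability of the columns -/

section Exchangeable

/-- The block diagonal matrix `diag (u, 1)` over `A_s(k)`. -/
def blockMatrix (k l : ℕ) (a b : Fin (k + l)) : QPerm k :=
  Fin.addCases (fun a => Fin.addCases (fun b => QPerm.u a b) (fun _ => 0) b)
    (fun a => Fin.addCases (fun _ => 0) (fun b => if a = b then 1 else 0) b) a

variable {k l : ℕ}

@[simp]
theorem blockMatrix_castAdd_castAdd (a b : Fin k) :
    blockMatrix k l (Fin.castAdd l a) (Fin.castAdd l b) = QPerm.u a b := by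
  simp [blockMatrix]

@[simp]
theorem blockMatrix_castAdd_natAdd (a : Fin k) (b : Fin l) :
    blockMatrix k l (Fin.castAdd l a) (Fin.natAdd k b) = 0 := by
  simp [blockMatrix]

@[simp]
theorem blockMatrix_natAdd_castAdd (a : Fin l) (b : Fin k) :
    blockMatrix k l (Fin.natAdd k a) (Fin.castAdd l b) = 0 := by
  simp [blockMatrix]

@[simp]
theorem blockMatrix_natAdd_natAdd (a b : Fin l) :
    blockMatrix k l (Fin.natAdd k a) (Fin.natAdd k b) = if a = b then 1 else 0 := by
  simp [blockMatrix]

theorem isMagicUnitary_blockMatrix : IsMagicUnitary (blockMatrix k l) := by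
  have hu := QPerm.isMagicUnitary_u (n := k)
  constructor
  · constructor
    · intro i j
      cases i using Fin.addCases <;> cases j using Fin.addCases <;> simp [hu.idem]
      exact fun h1 h2 => absurd h2 h1
    · intro i j j' h
      cases i using Fin.addCases <;> cases j using Fin.addCases <;>
        cases j' using Fin.addCases <;> simp <;> simp at h
      · exact hu.row_orth _ _ _ h
      · rintro rfl rfl
        exact absurd rfl h
    · intro i j j' h
      cases i using Fin.addCases <;> cases j using Fin.addCases <;>
        cases j' using Fin.addCases <;> simp <;> simp at h
      · exact hu.col_orth _ _ _ h
      · rintro rfl rfl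
        exact absurd rfl h
    · intro i
      rw [Fin.sum_univ_add]
      cases i using Fin.addCases <;> simp [hu.row_sum]
    · intro i
      rw [Fin.sum_univ_add]
      cases i using Fin.addCases <;> simp [hu.col_sum]
  · intro i j
    cases i using Fin.addCases <;> cases j using Fin.addCases <;> simp [hu.star_eq]
    split_ifs <;> simp

theorem word_blockMatrix_castAdd {m : ℕ} (i j : Fin m → Fin k) :
    word (blockMatrix k l) (Fin.castAdd l ∘ i) (Fin.castAdd l ∘ j) = word QPerm.u i j := by
  simp [word]

theorem word_blockMatrix_eq_zero {m : ℕ} (i : Fin m → Fin k) {J : Fin m → Fin (k + l)}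
    (hJ : J ∉ Set.range fun j : Fin m → Fin k => Fin.castAdd l ∘ j) :
    word (blockMatrix k l) (Fin.castAdd l ∘ i) J = 0 := by
  obtain ⟨r, hr⟩ : ∃ r, ∀ b, Fin.castAdd l b ≠ J r := by
    by_contra! h
    choose j hj using h
    exact hJ ⟨j, funext hj⟩
  obtain ⟨b, hb⟩ : ∃ b, J r = Fin.natAdd k b := by
    have h1 := hr
    generalize J r = p at h1
    cases p using Fin.addCases with
    | left b => exact absurd rfl (h1 b)
    | right b => exact ⟨b, rfl⟩
  refine List.prod_eq_zero (List.mem_ofFn.2 ⟨r, ?_⟩)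
  rw [hb, Function.comp_apply, blockMatrix_castAdd_natAdd]

/-- The invariance of the Haar state of `A_s(k + l)`, pushed forward to `A_s(k)` along the
homomorphism given by `diag (u, 1)`. -/
theorem QPerm.IsHaarState.sum_castAdd {ψ : QPerm (k + l) →ₚ[ℂ] ℂ} (hψ : QPerm.IsHaarState ψ)
    {m : ℕ} (i : Fin m → Fin k) (c : Fin m → Fin (k + l)) :
    ∑ j : Fin m → Fin k, ψ (word QPerm.u (Fin.castAdd l ∘ j) c) • word QPerm.u i j =
      ψ (word QPerm.u (Fin.castAdd l ∘ i) c) • (1 : QPerm k) := by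
  obtain ⟨f, hf, -⟩ := QPerm.existsUnique_starAlgHom (blockMatrix k l) isMagicUnitary_blockMatrix
  have h := congrArg f (hψ.sum_right (Fin.castAdd l ∘ i) c)
  simp only [map_sum, map_smul, map_word, hf, _root_.map_one] at h
  rw [← h]
  refine Fintype.sum_of_injective (fun j => Fin.castAdd l ∘ j)
    (fun j j' e => funext fun r => Fin.castAdd_injective k l (congrFun e r)) _ _
    (fun J hJ => ?_) (fun j => ?_)
  · rw [show word (fun a b => blockMatrix k l a b) (Fin.castAdd l ∘ i) J = 0 from
      word_blockMatrix_eq_zero i hJ, smul_zero]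
  · rw [← word_blockMatrix_castAdd (l := l) i j]

theorem gnsState_prod_toGnsVN {n m : ℕ} {ψ : QPerm n →ₚ[ℂ] ℂ} (i : Fin m → Fin n) (c : Fin n) :
    gnsState ψ (List.ofFn fun r => toGnsVN ψ (QPerm.u (i r) c)).prod =
      ψ (word QPerm.u i fun _ => c) := by
  let F : QPerm n →* (gnsVN ψ).toStarSubalgebra :=
    { toFun := toGnsVN ψ
      map_one' := Subtype.ext (map_one ψ.gnsStarAlgHom)
      map_mul' := fun a b => Subtype.ext (map_mul ψ.gnsStarAlgHom a b) }
  rw [← gnsState_toGnsVN]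
  exact congrArg (gnsState ψ) (map_word F QPerm.u i fun _ => c).symm

theorem quantumExchangeable_column {n : ℕ} {ψ : QPerm n →ₚ[ℂ] ℂ} (hψ : QPerm.IsHaarState ψ)
    (c : Fin n) :
    QuantumExchangeable (gnsState ψ) fun i : Fin n => toGnsVN ψ (QPerm.u i c) := by
  intro k hk m i
  obtain ⟨l, rfl⟩ := Nat.exists_eq_add_of_le hk
  simp only [gnsState_prod_toGnsVN]
  exact (hψ.sum_castAdd i fun _ => c).symm

end Exchangeable

/-! ### The columns are not free with amalgamation -/

section NotFree

variable {A : Type*} [Ring A] [Algebra ℂ A]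

/-- The polynomial `X - s`. -/
def BPoly.XSub (B : Type*) [Ring B] [Algebra ℂ B] (s : ℂ) : BPoly B :=
  RingQuot.mkAlgHom ℂ (BPolyRel B) (FreeAlgebra.ι ℂ none) - algebraMap ℂ _ s

theorem BPoly.eval_XSub (B : Subalgebra ℂ A) (a : A) (s : ℂ) :
    BPoly.eval B a (BPoly.XSub B s) = a - algebraMap ℂ A s := by
  rw [BPoly.XSub, map_sub, AlgHom.commutes, BPoly.eval, RingQuot.liftAlgHom_mkAlgHom_apply]
  simp

/-- A partition of unity into `n ≥ 2` mutually orthogonal elements is not free and identically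
distributed: all elements have expectation `1 / n`, so for two of them the expectation of
`(x - 1 / n) (y - 1 / n)` is `-1 / n ^ 2`. -/
theorem not_free_of_partition_of_unity {n : ℕ} (hn : 2 ≤ n) {B : Subalgebra ℂ A}
    {E : A →ₗ[ℂ] B} (hE : E 1 = 1) (hB : (1 : A) ≠ 0) {x : Fin n → A} (hsum : ∑ i, x i = 1)
    (horth : ∀ i j, i ≠ j → x i * x j = 0) (hid : IdenticallyDistributed B E x) :
    ¬ FreeWithAmalgamation B E x := by
  intro hfree
  have hn0 : (n : ℂ) ≠ 0 := Nat.cast_ne_zero.2 (by lia)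
  set s : ℂ := (n : ℂ)⁻¹ with hs
  have hEalg : ∀ c : ℂ, E (algebraMap ℂ A c) = c • 1 := fun c => by
    rw [Algebra.algebraMap_eq_smul_one, map_smul, hE]
  have hEx : ∀ i, E (x i) = s • 1 := by
    intro i
    have h1 : ∀ j, E (x j) = E (x i) := fun j => by
      have h2 := hid (BPoly.XSub B 0) j i
      simpa only [BPoly.eval_XSub, map_zero, sub_zero] using h2
    have h3 := congrArg E hsum
    rw [map_sum, Finset.sum_congr rfl fun j _ => h1 j, Finset.sum_const, Finset.card_univ,
      Fintype.card_fin, hE, ← Nat.cast_smul_eq_nsmul ℂ] at h3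
    rw [← h3, hs, inv_smul_smul₀ hn0]
  let a : Fin n := ⟨0, by lia⟩
  let b : Fin n := ⟨1, by lia⟩
  have hab : a ≠ b := by simp [a, b]
  have h := hfree 1 ![a, b] (fun _ => BPoly.XSub B s)
    (fun r => by rw [Subsingleton.elim r 0]; exact hab)
    (fun r => by rw [BPoly.eval_XSub, map_sub, hEx, hEalg, sub_self])
  have e : (x a - algebraMap ℂ A s) * (x b - algebraMap ℂ A s) =
      x a * x b - s • x a - s • x b + algebraMap ℂ A (s * s) := by
    simp only [sub_mul, mul_sub, map_mul, Algebra.smul_def, ← Algebra.commutes s (x a)]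
    abel
  simp only [BPoly.eval_XSub, List.ofFn_succ, List.ofFn_zero, List.prod_cons, List.prod_nil,
    mul_one, Matrix.cons_val_zero, Fin.succ_zero_eq_one, Matrix.cons_val_one] at h
  rw [e, horth a b hab, map_add, map_sub, map_sub, map_zero, map_smul, map_smul, hEx, hEx,
    hEalg] at h
  have h1 : (-(s * s)) • (1 : B) = 0 := by
    rw [← h, smul_smul]
    module
  rcases smul_eq_zero.1 h1 with h2 | h2
  · exact inv_ne_zero hn0 (mul_self_eq_zero.1 (neg_eq_zero.1 h2))
  · exact hB (congrArg Subtype.val h2)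

end NotFree

end QuantumDeFinetti

end

open QuantumDeFinetti in
theorem mainTheorem4 (n : ℕ) :
    (∃! ψ : QPerm n →ₚ[ℂ] ℂ, QPerm.IsHaarState ψ) ∧
    ∀ ψ : QPerm n →ₚ[ℂ] ℂ, QPerm.IsHaarState ψ →
      IsWStarProbabilitySpace (gnsVN ψ) (gnsState ψ) ∧
      (∀ a : QPerm n, gnsState ψ (toGnsVN ψ a) = ψ a) ∧
      ∀ c : Fin n,
        QuantumExchangeable (gnsState ψ) (fun i : Fin n => toGnsVN ψ (QPerm.u i c)) ∧
        (2 ≤ n →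
          ¬ ∃ (B : Subalgebra ℂ (gnsVN ψ).toStarSubalgebra)
              (E : (gnsVN ψ).toStarSubalgebra →ₗ[ℂ] B),
            IsVonNeumannSubalgebra (gnsVN ψ) B ∧
            IsConditionalExpectation B E ∧
            (∀ a, gnsState ψ (E a) = gnsState ψ a) ∧
            IdenticallyDistributed B E (fun i : Fin n => toGnsVN ψ (QPerm.u i c)) ∧
            FreeWithAmalgamation B E (fun i : Fin n => toGnsVN ψ (QPerm.u i c))) := by
  refine ⟨QPerm.existsUnique_isHaarState n, fun ψ hψ =>
    ⟨isWStarProbabilitySpace_gns hψ.map_one hψ.apply_mul_comm, gnsState_toGnsVN,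
      fun c => ⟨quantumExchangeable_column hψ c, ?_⟩⟩⟩
  rintro hn ⟨B, E, -, hE, -, hid, hfree⟩
  have hu := QPerm.isMagicUnitary_u (n := n)
  refine not_free_of_partition_of_unity hn (hE.apply_coe 1) (fun h => ?_)
    (Subtype.ext ?_) (fun i j hij => Subtype.ext ?_) hid hfree
  · have h1 := gnsState_one hψ.map_one
    rw [h, map_zero] at h1
    exact zero_ne_one h1
  · change ((∑ i, toGnsVN ψ (QPerm.u i c) : (gnsVN ψ).toStarSubalgebra) : ψ.GNS →L[ℂ] ψ.GNS) = 1
    rw [AddSubmonoidClass.coe_finsetSum]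
    change ∑ i, ψ.gnsStarAlgHom (QPerm.u i c) = 1
    rw [← map_sum, hu.col_sum, map_one]
  · change ψ.gnsStarAlgHom (QPerm.u i c) * ψ.gnsStarAlgHom (QPerm.u j c) = 0
    rw [← map_mul, hu.col_orth c i j hij, map_zero]
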